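/- Let $p\ge 0$ be an integer and let $\{Z_t\}_{t\in\mathbb Z}$ be i.i.d. real random variables with $\mathbb E(Z_t)=0$ and $\mathbb E(Z_t^2)=1$. Let $a_0,\dots,a_p:(0,1]\to[0,\infty)$ satisfy: (i) there are $0<\rho_1\le\rho_2<\infty$ and $0<\delta_1<1$ with $\rho_1\le a_0(u)\le\rho_2$ for all $u\in(0,1]$ and $\sup_u\sum_{j=1}^p a_j(u)\le 1-\delta_1$; (ii) there are $\beta\in(0,1]$ and $0<K<\infty$ with $|a_j(u)-a_j(v)|\le K|u-v|^\beta$ for all $u,v\in(0,1]$ and $j=0,\dots,p$. Let $\{X_{t,N}\}$ be a tvARCH($p$) process, that is, for every $N\ge1$ and $t=1,\dots,N$, $$X_{t,N}=\sigma_{t,N}Z_t,\qquad \sigma_{t,N}^2=a_0\left(\tfrac tN\right)+\sum_{j=1}^p a_j\left(\tfrac tN\right)X_{t-j,N}^2,\qquad \sigma_{t,N}\ge 0,$$ where the initial values $X_{1-p,N},\dots,X_{0,N}$ are bounded in probability uniformly in $N$. For $u\in(0,1]$ let $\{\tilde X_t(u)\}_{t\in\mathbb Z}$ be the (strictly) stationary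 process with $\tilde X_t(u)=\tilde\sigma_t(u)Z_t$, $\tilde\sigma_t^2(u)=a_0(u)+\sum_{j=1}^p a_j(u)\tilde X_{t-j}^2(u)$, $\tilde\sigma_t(u)\ge 0$, for all $t\in\mathbb Z$, and put $\mu(u)=\mathbb E(\tilde X_t^2(u))$ and $c(u,h)=\operatorname{cov}\{\tilde X_t^2(u),\tilde X_{t+h}^2(u)\}$, $h\ge0$. Assume that for some $0<\zeta\le2$ and $0<\delta<1$ $$\mathbb E(|Z_t|^{2(2+\zeta)})<\infty,\qquad \{\mathbb E(|Z_t|^{2(2+\zeta)})\}^{1/(2+\zeta)}\,\sup_u\sum_{j=1}^p a_j(u)\le 1-\delta .$$ Let, for $N>h$, $$\mathcal S_N(h)=\frac1{N-h}\sum_{t=1}^{N-h}X_{t,N}^2X_{t+h,N}^2-\Bigl(\frac1{N-h}\sum_{t=1}^{N-h}X_{t,N}^2\Bigr)^2$$ be the sample autocovariance of the squares, computed as if the process were stationary. Then $\mathbb E(\tilde X_t^4(u))<\infty$ for all $u\in(0,1]$ and $t\in\mathbb Z$, the integrals below exist for every $h\ge 0$ and, for each fixed $h>0$, as $N\to\infty$,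 $$\mathcal S_N(h)\ \xrightarrow{\ \mathcal P\ }\ \int_0^1 c(u,h)\,du+\iint_{\{0\le u<v\le1\}}\{\mu(u)-\mu(v)\}^2\,du\,dv .$$ Hence a spurious long-memory effect appears whenever the local mean varies: there are $C<\infty$ and $\rho\in(0,1)$ such that $\bigl|\int_0^1c(u,h)\,du\bigr|\le C\rho^h$ for all $h\ge0$, while the second integral, which does not depend on $h$, is strictly positive as soon as $\mu$ is not constant on $(0,1]$. -/

import Mathlib

open MeasureTheory ProbabilityTheory Set Filter Topology

noncomputable section

namespace TvARCH

variable {Ω : Type*} [MeasurableSpace Ω]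

/-- Innovations: `Z_t`, `t ∈ ℤ`, are i.i.d. real random variables with mean `0` and variance `1`
(the last equation forces `Z_t` to be square integrable, as the Bochner integral of a
non-integrable function is `0`). -/
structure IsInnovation (P : Measure Ω) (Z : ℤ → Ω → ℝ) : Prop where
  measurable : ∀ t, Measurable (Z t)
  indep : iIndepFun Z P
  identDistrib : ∀ t, IdentDistrib (Z t) (Z 0) P P
  mean_zero : ∫ ω, Z 0 ω ∂P = 0
  second_moment : ∫ ω, (Z 0 ω) ^ 2 ∂P = 1

/-- The ARCH(p) volatility `σ = (a₀(u) + ∑_{j=1}^p a_j(u) x_{t-j}²)^{1/2}` at time `t`, with the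
parameters taken at the rescaled time `u`, for the path `x`. -/
def volatility (p : ℕ) (a : ℕ → ℝ → ℝ) (u : ℝ) (x : ℤ → ℝ) (t : ℤ) : ℝ :=
  √(a 0 u + ∑ j ∈ Finset.Icc 1 p, a j u * (x (t - (j : ℤ))) ^ 2)

/-- `X N t` (for `X_{t,N}`) is a tvARCH(p) process: the parameter functions are nonnegative on
`(0, 1]`, `X_{t,N} = σ_{t,N} Z_t` for `t = 1, …, N`, and the initial values
`X_{1-p,N}, …, X_{0,N}`, which the recursion needs, are bounded in probability uniformly
in `N`. The values at all other times are irrelevant. -/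
structure IsTvARCH (P : Measure Ω) (p : ℕ) (a : ℕ → ℝ → ℝ) (Z : ℤ → Ω → ℝ)
    (X : ℕ → ℤ → Ω → ℝ) : Prop where
  param_nonneg : ∀ j ≤ p, ∀ u ∈ Ioc (0 : ℝ) 1, 0 ≤ a j u
  measurable : ∀ N t, Measurable (X N t)
  model : ∀ N : ℕ, ∀ t : ℤ, 1 ≤ t → t ≤ (N : ℤ) →
    ∀ᵐ ω ∂P, X N t ω = volatility p a ((t : ℝ) / (N : ℝ)) (fun s => X N s ω) t * Z t ω
  initial_tight : ∀ t : ℤ, 1 - (p : ℤ) ≤ t → t ≤ 0 →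
    ∀ ε : ℝ, 0 < ε → ∃ C : ℝ, ∀ N : ℕ, P {ω | C < |X N t ω|} ≤ ENNReal.ofReal ε

/-- Boundedness of the parameters: `0 < ρ₁ ≤ a₀ ≤ ρ₂ < ∞` on `(0, 1]` and
`sup_u ∑_{j=1}^p a_j(u) ≤ 1 - δ`. -/
def ParamBounded (p : ℕ) (a : ℕ → ℝ → ℝ) : Prop :=
  ∃ ρ₁ ρ₂ δ : ℝ, 0 < ρ₁ ∧ ρ₁ ≤ ρ₂ ∧ 0 < δ ∧ δ < 1 ∧
    ∀ u ∈ Ioc (0 : ℝ) 1, ρ₁ ≤ a 0 u ∧ a 0 u ≤ ρ₂ ∧ ∑ j ∈ Finset.Icc 1 p, a j u ≤ 1 - δ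

/-- Hölder continuity of the parameters on `(0, 1]`. -/
def ParamHolder (p : ℕ) (a : ℕ → ℝ → ℝ) : Prop :=
  ∃ β K : ℝ, 0 < β ∧ β ≤ 1 ∧ 0 < K ∧
    ∀ j ≤ p, ∀ u ∈ Ioc (0 : ℝ) 1, ∀ v ∈ Ioc (0 : ℝ) 1, |a j u - a j v| ≤ K * |u - v| ^ β

/-- The `(2+ζ)`-moment contraction: `Z` has a finite moment of order `2(2+ζ)` and
`(E|Z_t|^{2(2+ζ)})^{1/(2+ζ)} sup_u ∑_{j=1}^p a_j(u) ≤ 1 - δ`. -/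
def MomentContraction (P : Measure Ω) (p : ℕ) (a : ℕ → ℝ → ℝ) (Z : ℤ → Ω → ℝ)
    (ζ δ : ℝ) : Prop :=
  Integrable (fun ω => |Z 0 ω| ^ (2 * (2 + ζ))) P ∧
    ∀ u ∈ Ioc (0 : ℝ) 1,
      (∫ ω, |Z 0 ω| ^ (2 * (2 + ζ)) ∂P) ^ (1 / (2 + ζ)) * ∑ j ∈ Finset.Icc 1 p, a j u ≤ 1 - δ

/-- `Y` is a (strictly) stationary ARCH(p) process with the parameters frozen at `u`, driven by
the innovations `Z`: `Y_t = σ̃_t Z_t`, `σ̃_t² = a₀(u) + ∑_j a_j(u) Y_{t-j}²` for all `t ∈ ℤ`,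
and the law of the path is invariant under time shifts. -/
structure IsStationaryARCH (P : Measure Ω) (p : ℕ) (a : ℕ → ℝ → ℝ) (Z : ℤ → Ω → ℝ) (u : ℝ)
    (Y : ℤ → Ω → ℝ) : Prop where
  measurable : ∀ t, Measurable (Y t)
  model : ∀ t : ℤ, ∀ᵐ ω ∂P, Y t ω = volatility p a u (fun s => Y s ω) t * Z t ω
  stationary : ∀ s : ℤ,
    IdentDistrib (fun ω (t : ℤ) => Y (t + s) ω) (fun ω (t : ℤ) => Y t ω) P P

/-- The local mean `μ(u) = E(X̃_t(u)²)`; the expectation does not depend on `t`. -/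
def localMean (P : Measure Ω) (Xt : ℝ → ℤ → Ω → ℝ) (u : ℝ) : ℝ :=
  ∫ ω, (Xt u 0 ω) ^ 2 ∂P

/-- The local autocovariance `c(u, h) = cov(X̃_t(u)², X̃_{t+h}(u)²)`; it does not depend
on `t`. -/
def localCov (P : Measure Ω) (Xt : ℝ → ℤ → Ω → ℝ) (u : ℝ) (h : ℕ) : ℝ :=
  cov[fun ω => (Xt u 0 ω) ^ 2, fun ω => (Xt u (h : ℤ) ω) ^ 2; P]

/-- The sample mean `(N - h)⁻¹ ∑_{t=1}^{N-h} X_{t,N}²`. -/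
def sampleMean (X : ℕ → ℤ → Ω → ℝ) (h N : ℕ) (ω : Ω) : ℝ :=
  1 / ((N : ℝ) - (h : ℝ)) * ∑ t ∈ Finset.Icc (1 : ℤ) ((N : ℤ) - (h : ℤ)), (X N t ω) ^ 2

/-- The sample autocovariance at lag `h`,
`S_N(h) = (N - h)⁻¹ ∑_{t=1}^{N-h} X_{t,N}² X_{t+h,N}² - (sample mean)²`. -/
def sampleAutocov (X : ℕ → ℤ → Ω → ℝ) (h N : ℕ) (ω : Ω) : ℝ :=
  1 / ((N : ℝ) - (h : ℝ)) *
      ∑ t ∈ Finset.Icc (1 : ℤ) ((N : ℤ) - (h : ℤ)), (X N t ω) ^ 2 * (X N (t + (h : ℤ)) ω) ^ 2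
    - (sampleMean X h N ω) ^ 2

/-- The triangle `{0 ≤ u < v ≤ 1}`. -/
def triangle : Set (ℝ × ℝ) := {q | 0 ≤ q.1 ∧ q.1 < q.2 ∧ q.2 ≤ 1}

/-- `∫_0^1 c(u, h) du`. -/
def meanLocalCov (P : Measure Ω) (Xt : ℝ → ℤ → Ω → ℝ) (h : ℕ) : ℝ :=
  ∫ u in (0 : ℝ)..1, localCov P Xt u h

/-- `∬_{0 ≤ u < v ≤ 1} (μ(u) - μ(v))² du dv`. -/
def meanVariation (P : Measure Ω) (Xt : ℝ → ℤ → Ω → ℝ) : ℝ :=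
  ∫ q in triangle, (localMean P Xt q.1 - localMean P Xt q.2) ^ 2

end TvARCH

end

noncomputable section

namespace TvARCH

variable {Ω : Type*} [MeasurableSpace Ω] {P : Measure Ω}

/-! The squares of an ARCH process solve a linear recursion `x_t = w_t (b₀(t) + ∑ b_j(t) x_{t-j})`
with `w_t = Z_t²` independent of the past. Independence makes the `L²`-norm multiplicative on `w_t`
times the bracket, so the recursion contracts in `L²` with factor `κ ∑ b_j ≤ q = 1 - δ < 1`, where
`κ` is the `L^{2+ζ}`-norm of `Z²` and dominates its `L²`-norm. Control of the squares in `L²` is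
exactly what products at two times require.

Picard iteration from `0` therefore converges to a causal solution `archLim`, with error `O(q^k)`
after `k` steps, and the `k`-th iterate uses only innovations in a window of length `kp`
(`archLim_sub_norm`, `measurable_arch_sig`). Two solutions differ pathwise by their discrepancy on
`p` initial values times a homogeneous solution of norm `r^(t-s)`, where `r^(p+1) = q`
(`abs_sub_le_decayRec`, `decayRec_norm`). As it is enough that the discrepancy is bounded in
probability, the squares of any stationary solution are the causal ones (`ae_eq_archLim`), and the
initial values of the tvARCH process are forgotten.

On a window of about `√N` steps the rescaled time moves by `O(N^{-1/2})`, so Hölder continuity of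
the parameters lets `X_{t,N}²` and `X_{t+h,N}²` both be replaced by the stationary squares with
parameters frozen at `t/N` (`abs_sq_sub_localSq_le`, `localError_norm`). Averages of these and of
their products obey a weak law of large numbers, because they are approximated uniformly by bounded,
finitely dependent variables (`tendsto_integral_abs_avg`). Their expectations are Hölder continuous
in `u`, so the averaged expectations are convergent Riemann sums.

The limit of the autocovariance is thus `∫ E(x_0 x_h) - (∫ μ)² = ∫ c + (∫ μ² - (∫ μ)²)`. The last
bracket is the variance of `μ` at a uniform point, that is, half the integral of `(μ(u) - μ(v))²`
over the square, or its integral over the triangle (`setIntegral_triangle`). It is positive once the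
continuous function `μ` varies. Finally, `c(u, h)` decays geometrically because iterates over
disjoint windows are independent. -/

/-- `f` has `L²`-norm at most `c`. -/
def NormLe (P : Measure Ω) (f : Ω → ℝ) (c : ℝ) : Prop :=
  AEStronglyMeasurable f P ∧ eLpNorm f 2 P ≤ ENNReal.ofReal c

/-! ### Calculus of `L²`-bounds -/

namespace NormLe

variable {f g : Ω → ℝ} {c d : ℝ}

theorem memLp (h : NormLe P f c) : MemLp f 2 P := ⟨h.1, h.2.trans_lt ENNReal.ofReal_lt_top⟩

theorem mono (h : NormLe P f c) (hcd : c ≤ d) : NormLe P f d :=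
  ⟨h.1, h.2.trans (ENNReal.ofReal_le_ofReal hcd)⟩

theorem of_abs_le (h : NormLe P g c) (hf : AEStronglyMeasurable f P)
    (hfg : ∀ᵐ ω ∂P, |f ω| ≤ |g ω|) : NormLe P f c :=
  ⟨hf, (eLpNorm_mono_ae (by simpa using hfg)).trans h.2⟩

theorem congr (h : NormLe P g c) (hfg : f =ᵐ[P] g) : NormLe P f c :=
  ⟨h.1.congr hfg.symm, (eLpNorm_congr_ae hfg).trans_le h.2⟩

theorem zero : NormLe P (fun _ => 0) c :=
  ⟨aestronglyMeasurable_const, by simp⟩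

theorem add (hf : NormLe P f c) (hg : NormLe P g d) (hc : 0 ≤ c) (hd : 0 ≤ d) :
    NormLe P (fun ω => f ω + g ω) (c + d) := by
  refine ⟨hf.1.add hg.1, (eLpNorm_add_le hf.1 hg.1 (by norm_num)).trans ?_⟩
  rw [ENNReal.ofReal_add hc hd]
  exact add_le_add hf.2 hg.2

theorem neg (hf : NormLe P f c) : NormLe P (fun ω => - f ω) c :=
  ⟨hf.1.neg, (eLpNorm_neg f 2 P).trans_le hf.2⟩

theorem abs (hf : NormLe P f c) : NormLe P (fun ω => |f ω|) c :=
  hf.of_abs_le hf.1.norm (by simp)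

theorem sub (hf : NormLe P f c) (hg : NormLe P g d) (hc : 0 ≤ c) (hd : 0 ≤ d) :
    NormLe P (fun ω => f ω - g ω) (c + d) := by
  simpa [sub_eq_add_neg] using hf.add hg.neg hc hd

theorem const_mul (hf : NormLe P f c) {a : ℝ} (ha : 0 ≤ a) :
    NormLe P (fun ω => a * f ω) (a * c) := by
  refine ⟨hf.1.const_mul a, ?_⟩
  have h := eLpNorm_const_smul a f 2 P
  rw [show (fun ω => a * f ω) = a • f from rfl, h, ENNReal.ofReal_mul ha,
    Real.enorm_eq_ofReal ha]
  gcongr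
  exact hf.2

theorem const [IsProbabilityMeasure P] {a : ℝ} (ha : 0 ≤ a) : NormLe P (fun _ => a) a := by
  refine ⟨aestronglyMeasurable_const, ?_⟩
  rw [eLpNorm_const a (by norm_num) (IsProbabilityMeasure.ne_zero P)]
  simp [Real.enorm_eq_ofReal ha]

theorem sum {ι : Type*} (s : Finset ι) {f : ι → Ω → ℝ} {c : ι → ℝ}
    (hf : ∀ i ∈ s, NormLe P (f i) (c i)) (hc : ∀ i ∈ s, 0 ≤ c i) :
    NormLe P (fun ω => ∑ i ∈ s, f i ω) (∑ i ∈ s, c i) := by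
  classical
  induction s using Finset.induction_on with
  | empty => simpa using NormLe.zero
  | insert i s hi ih =>
    simp only [Finset.sum_insert hi]
    refine NormLe.add (hf i (by simp)) (ih (fun j hj => hf j (by simp [hj]))
      (fun j hj => hc j (by simp [hj]))) (hc i (by simp))
      (Finset.sum_nonneg fun j hj => hc j (by simp [hj]))

/-- Cauchy–Schwarz, as Hölder's inequality with exponents `2`, `2`, `1`. -/
theorem lintegral_mul_le (hf : NormLe P f c) (hg : NormLe P g d) (hc : 0 ≤ c) :
    ∫⁻ ω, ENNReal.ofReal |f ω * g ω| ∂P ≤ ENNReal.ofReal (c * d) := by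
  have h := eLpNorm_smul_le_mul_eLpNorm (p := 2) (q := 2) (r := 1) hg.1 hf.1
  rw [eLpNorm_one_eq_lintegral_enorm] at h
  simp only [Pi.smul_apply', smul_eq_mul, Real.enorm_eq_ofReal_abs] at h
  refine h.trans ?_
  rw [ENNReal.ofReal_mul hc]
  exact mul_le_mul' hf.2 hg.2

theorem integrable_mul (hf : NormLe P f c) (hg : NormLe P g d) :
    Integrable (fun ω => f ω * g ω) P :=
  hf.memLp.integrable_mul hg.memLp

theorem integral_abs_mul_le (hf : NormLe P f c) (hg : NormLe P g d) (hc : 0 ≤ c) (hd : 0 ≤ d) :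
    ∫ ω, |f ω * g ω| ∂P ≤ c * d := by
  have h := hf.lintegral_mul_le hg hc
  rw [integral_eq_lintegral_of_nonneg_ae (Eventually.of_forall fun _ => abs_nonneg _)
    (show AEStronglyMeasurable (fun ω => |f ω * g ω|) P from (hf.1.mul hg.1).norm)]
  exact ENNReal.toReal_le_of_le_ofReal (by positivity) h

theorem abs_integral_mul_le (hf : NormLe P f c) (hg : NormLe P g d) (hc : 0 ≤ c) (hd : 0 ≤ d) :
    |∫ ω, f ω * g ω ∂P| ≤ c * d :=
  (abs_integral_le_integral_abs).trans (hf.integral_abs_mul_le hg hc hd)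

theorem integrable [IsProbabilityMeasure P] (hf : NormLe P f c) : Integrable f P :=
  hf.memLp.integrable (by norm_num)

theorem integral_abs_le [IsProbabilityMeasure P] (hf : NormLe P f c) (hc : 0 ≤ c) :
    ∫ ω, |f ω| ∂P ≤ c := by
  simpa using hf.integral_abs_mul_le (NormLe.const zero_le_one) hc zero_le_one

theorem abs_integral_le [IsProbabilityMeasure P] (hf : NormLe P f c) (hc : 0 ≤ c) :
    |∫ ω, f ω ∂P| ≤ c :=
  (abs_integral_le_integral_abs).trans (hf.integral_abs_le hc)

/-- The `L²`-norm is multiplicative on independent factors. -/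
theorem mul_of_indepFun (hf : NormLe P f c) (hg : NormLe P g d) (hc : 0 ≤ c)
    (hfm : Measurable f) (hgm : Measurable g) (h : IndepFun f g P) :
    NormLe P (fun ω => f ω * g ω) (c * d) := by
  refine ⟨hf.1.mul hg.1, ?_⟩
  have hsq : ∀ u : Ω → ℝ, eLpNorm u 2 P = (∫⁻ ω, ‖u ω‖ₑ ^ 2 ∂P) ^ (1 / 2 : ℝ) := by
    intro u
    rw [eLpNorm_eq_lintegral_rpow_enorm_toReal (by norm_num) (by norm_num)]
    simp
  have key : eLpNorm (fun ω => f ω * g ω) 2 P = eLpNorm f 2 P * eLpNorm g 2 P := by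
    rw [hsq, hsq, hsq, ← ENNReal.mul_rpow_of_nonneg _ _ (by norm_num)]
    congr 1
    rw [← lintegral_mul_eq_lintegral_mul_lintegral_of_indepFun (f := fun ω => ‖f ω‖ₑ ^ 2)
      (g := fun ω => ‖g ω‖ₑ ^ 2) (by fun_prop) (by fun_prop)
      (h.comp (φ := fun x => ‖x‖ₑ ^ 2) (ψ := fun x => ‖x‖ₑ ^ 2) (by fun_prop) (by fun_prop))]
    simp [mul_pow]
  rw [key, ENNReal.ofReal_mul hc]
  exact mul_le_mul' hf.2 hg.2

/-- Fatou's lemma: the `L²`-norm is lower semicontinuous under almost sure convergence. -/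
theorem of_tendsto {f : ℕ → Ω → ℝ} (hf : ∀ᶠ n in atTop, NormLe P (f n) c)
    (hm : ∀ n, AEStronglyMeasurable (f n) P)
    (hg : ∀ᵐ ω ∂P, Tendsto (fun n => f n ω) atTop (𝓝 (g ω))) : NormLe P g c := by
  refine ⟨aestronglyMeasurable_of_tendsto_ae _ hm hg, ?_⟩
  refine (Lp.eLpNorm_lim_le_liminf_eLpNorm hm g hg).trans ?_
  refine Filter.liminf_le_of_le (by isBoundedDefault) fun b hb => ?_
  obtain ⟨n, h1, h2⟩ := (hb.and hf).exists
  exact h1.trans h2.2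

/-- Markov's inequality. -/
theorem measure_lt_le [IsProbabilityMeasure P] (hf : NormLe P f c) (hc : 0 ≤ c) {C : ℝ}
    (hC : 0 < C) : P {ω | C < |f ω|} ≤ ENNReal.ofReal (c / C) := by
  have h := mul_meas_ge_le_lintegral₀ (μ := P) (f := fun ω => ENNReal.ofReal |f ω|)
    hf.1.norm.aemeasurable.ennreal_ofReal (ENNReal.ofReal C)
  have h2 := hf.lintegral_mul_le (NormLe.const (P := P) zero_le_one) hc
  simp only [mul_one] at h2
  rw [ENNReal.ofReal_div_of_pos hC, ENNReal.le_div_iff_mul_le (by simp [hC]) (by simp)]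
  rw [mul_comm]
  refine le_trans ?_ (h.trans h2)
  gcongr
  exact fun hω => ENNReal.ofReal_le_ofReal (le_of_lt hω)

end NormLe

/-! ### The squared ARCH recursion: Picard iterates and the causal solution -/

/-- The `k`-th Picard iterate, started at `0`, of the squared ARCH recursion
`x_t = w_t (b₀(t) + ∑_{j=1}^p b_j(t) x_{t-j})`. -/
def arch (p : ℕ) (b : ℕ → ℤ → ℝ) (w : ℤ → Ω → ℝ) : ℕ → ℤ → Ω → ℝ
  | 0, _, _ => 0
  | k + 1, t, ω => w t ω * (b 0 t + ∑ j ∈ Finset.Icc 1 p, b j t * arch p b w k (t - (j : ℤ)) ω)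

theorem arch_succ (p : ℕ) (b : ℕ → ℤ → ℝ) (w : ℤ → Ω → ℝ) (k : ℕ) (t : ℤ) :
    arch p b w (k + 1) t = fun ω =>
      w t ω * (b 0 t + ∑ j ∈ Finset.Icc 1 p, b j t * arch p b w k (t - (j : ℤ)) ω) := rfl

/-- The coefficients `b` are nonnegative, `b₀` is at most `R`, and `∑_{j ≥ 1} b_j` is small
compared with `κ⁻¹`. -/
structure Coef (p : ℕ) (κ R q : ℝ) (b : ℕ → ℤ → ℝ) : Prop where
  nonneg : ∀ j ≤ p, ∀ t, 0 ≤ b j t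
  zero_le : ∀ t, b 0 t ≤ R
  sum_le : ∀ t, ∑ j ∈ Finset.Icc 1 p, b j t ≤ 1
  contr : ∀ t, κ * ∑ j ∈ Finset.Icc 1 p, b j t ≤ q

/-- The nonnegative innovations `φ(z_t)` are functions of independent variables, with `L²`-norm
at most `κ`. -/
structure Innov (P : Measure Ω) (z : ℤ → Ω → ℝ) (φ : ℝ → ℝ) (κ : ℝ) : Prop where
  measurable : ∀ t, Measurable (z t)
  indep : iIndepFun z P
  measurable_fun : Measurable φ
  nonneg : ∀ x, 0 ≤ φ x
  pos : 0 ≤ κ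
  norm : ∀ t, NormLe P (fun ω => φ (z t ω)) κ

/-- The σ-algebra generated by `z_i`, `i ∈ S`. -/
@[reducible] def sig (z : ℤ → Ω → ℝ) (S : Set ℤ) : MeasurableSpace Ω :=
  ⨆ i ∈ S, MeasurableSpace.comap (z i) inferInstance

theorem sig_mono (z : ℤ → Ω → ℝ) {S T : Set ℤ} (h : S ⊆ T) : sig z S ≤ sig z T :=
  biSup_mono h

theorem sig_le {z : ℤ → Ω → ℝ} (hz : ∀ t, Measurable (z t)) (S : Set ℤ) :
    sig z S ≤ ‹MeasurableSpace Ω› :=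
  iSup₂_le fun i _ => (hz i).comap_le

theorem measurable_sig (z : ℤ → Ω → ℝ) {S : Set ℤ} {t : ℤ} (ht : t ∈ S) :
    Measurable[sig z S] (z t) :=
  (comap_measurable (z t)).mono (le_iSup₂_of_le t ht le_rfl) le_rfl

theorem indepFun_of_disjoint {z : ℤ → Ω → ℝ} (hz : ∀ t, Measurable (z t)) (h : iIndepFun z P)
    {S T : Set ℤ} (hST : Disjoint S T) {f g : Ω → ℝ} (hf : Measurable[sig z S] f)
    (hg : Measurable[sig z T] g) : IndepFun f g P := by
  have := indep_iSup_of_disjoint (fun i => (hz i).comap_le) h.iIndep hST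
  exact indep_of_indep_of_le_left (indep_of_indep_of_le_right this hg.comap_le) hf.comap_le

section arch

variable {p : ℕ} {b : ℕ → ℤ → ℝ} {κ R q : ℝ} {z : ℤ → Ω → ℝ} {φ : ℝ → ℝ}

/-- Each iteration looks back at most `p` steps. The finite window is the source of the finite
dependence in the law of large numbers and of the decay of the autocovariances. -/
theorem measurable_arch_sig (hφ : Measurable φ) (k : ℕ) (t : ℤ) :
    Measurable[sig z (Icc (t - k * p) t)] (arch p b (fun s ω => φ (z s ω)) k t) := by
  induction k generalizing t with
  | zero => exact measurable_const
  | succ k ih =>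
    rw [arch_succ]
    have h1 : Measurable[sig z (Icc (t - (k + 1 : ℕ) * p) t)] (z t) :=
      measurable_sig z ⟨by nlinarith [Int.natCast_nonneg p, Int.natCast_nonneg (k + 1)], le_rfl⟩
    refine Measurable.mul (hφ.comp h1) (Measurable.const_add ?_ _)
    refine Finset.measurable_sum _ fun j hj => Measurable.const_mul ?_ _
    rw [Finset.mem_Icc] at hj
    refine (ih (t - j)).mono (sig_mono z (Icc_subset_Icc ?_ ?_)) le_rfl
    · push_cast; nlinarith
    · omega

theorem Innov.measurable_arch (hI : Innov P z φ κ) (k : ℕ) (t : ℤ) :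
    Measurable (arch p b (fun s ω => φ (z s ω)) k t) :=
  (measurable_arch_sig hI.measurable_fun k t).mono (sig_le hI.measurable _) le_rfl

theorem Innov.measurable_innov (hI : Innov P z φ κ) (t : ℤ) : Measurable fun ω => φ (z t ω) :=
  hI.measurable_fun.comp (hI.measurable t)

theorem measurable_arch_past (hφ : Measurable φ) (k : ℕ) {s t : ℤ} (hst : s < t) :
    Measurable[sig z (Iio t)] (arch p b (fun s ω => φ (z s ω)) k s) :=
  (measurable_arch_sig hφ k s).mono (sig_mono z fun _ hi => hi.2.trans_lt hst) le_rfl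

/-- An innovation times a function of the past. -/
theorem Innov.mul_past (hI : Innov P z φ κ) {t : ℤ} {f : Ω → ℝ} {c : ℝ}
    (hf : Measurable[sig z (Iio t)] f) (hc : NormLe P f c) :
    NormLe P (fun ω => φ (z t ω) * f ω) (κ * c) :=
  (hI.norm t).mul_of_indepFun hc hI.pos (hI.measurable_innov t)
    (hf.mono (sig_le hI.measurable _) le_rfl)
    (indepFun_of_disjoint hI.measurable hI.indep (S := {t}) (T := Iio t) (by simp)
      (hI.measurable_fun.comp (measurable_sig z (mem_singleton t))) hf)

theorem arch_nonneg (hb : Coef p κ R q b) {w : ℤ → Ω → ℝ} (hw : ∀ t ω, 0 ≤ w t ω) (k : ℕ) (t : ℤ)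
    (ω : Ω) : 0 ≤ arch p b w k t ω := by
  induction k generalizing t with
  | zero => exact le_rfl
  | succ k ih =>
    unfold arch
    refine mul_nonneg (hw t ω) (add_nonneg (hb.nonneg 0 (Nat.zero_le _) t) ?_)
    exact Finset.sum_nonneg fun j hj =>
      mul_nonneg (hb.nonneg j (Finset.mem_Icc.1 hj).2 t) (ih _)

theorem Coef.sum_mul_le (hb : Coef p κ R q b) {A : ℝ} (hA : 0 ≤ A) (t : ℤ) :
    κ * ∑ j ∈ Finset.Icc 1 p, b j t * A ≤ q * A := by
  rw [← Finset.sum_mul, ← mul_assoc]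
  exact mul_le_mul_of_nonneg_right (hb.contr t) hA

theorem Coef.nonneg' (hb : Coef p κ R q b) {j : ℕ} (hj : j ∈ Finset.Icc 1 p) (t : ℤ) :
    0 ≤ b j t := hb.nonneg j (Finset.mem_Icc.1 hj).2 t

theorem Coef.R_nonneg (hb : Coef p κ R q b) : 0 ≤ R :=
  (hb.nonneg 0 (Nat.zero_le _) 0).trans (hb.zero_le 0)

/-- The bound is the fixed point of `A = κ R + q A`, hence is preserved by one step of the
recursion. -/
theorem arch_norm [IsProbabilityMeasure P] (hI : Innov P z φ κ) (hb : Coef p κ R q b)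
    (hq : q < 1) (k : ℕ) (t : ℤ) :
    NormLe P (arch p b (fun s ω => φ (z s ω)) k t) (κ * R / (1 - q)) := by
  have hA : 0 ≤ κ * R / (1 - q) :=
    div_nonneg (mul_nonneg hI.pos hb.R_nonneg) (by linarith)
  set A := κ * R / (1 - q) with hAdef
  induction k generalizing t with
  | zero => exact NormLe.zero
  | succ k ih =>
    have h1 : NormLe P (fun ω => b 0 t + ∑ j ∈ Finset.Icc 1 p,
        b j t * arch p b (fun s ω => φ (z s ω)) k (t - (j : ℤ)) ω)
        (b 0 t + ∑ j ∈ Finset.Icc 1 p, b j t * A) := by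
      refine (NormLe.const (hb.nonneg 0 (Nat.zero_le _) t)).add (NormLe.sum _ (fun j hj => ?_) ?_)
        (hb.nonneg 0 (Nat.zero_le _) t) ?_
      · exact (ih _).const_mul (hb.nonneg' hj t)
      · exact fun j hj => mul_nonneg (hb.nonneg' hj t) hA
      · exact Finset.sum_nonneg fun j hj => mul_nonneg (hb.nonneg' hj t) hA
    rw [arch_succ]
    refine (hI.mul_past ?_ h1).mono ?_
    · refine Measurable.const_add (Finset.measurable_sum _ fun j hj => Measurable.const_mul ?_ _) _
      exact measurable_arch_past hI.measurable_fun k (by have := Finset.mem_Icc.1 hj; omega)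
    · have h2 := hb.sum_mul_le hA t
      have h3 : A * (1 - q) = κ * R := by rw [hAdef]; field_simp [show (1 - q) ≠ 0 by linarith]
      have h4 := mul_le_mul_of_nonneg_left (hb.zero_le t) hI.pos
      rw [mul_add]
      linarith

/-- The intercept `b₀` cancels in the difference of successive iterates, so each step multiplies the
norm by at most `q`. -/
theorem arch_succ_sub_norm [IsProbabilityMeasure P] (hI : Innov P z φ κ) (hb : Coef p κ R q b)
    (hq0 : 0 ≤ q) (hq : q < 1) (k : ℕ) (t : ℤ) :
    NormLe P (fun ω => arch p b (fun s ω => φ (z s ω)) (k + 1) t ω -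
      arch p b (fun s ω => φ (z s ω)) k t ω) (κ * R / (1 - q) * q ^ k) := by
  have hA : 0 ≤ κ * R / (1 - q) :=
    div_nonneg (mul_nonneg hI.pos hb.R_nonneg) (by linarith)
  set A := κ * R / (1 - q) with hAdef
  induction k generalizing t with
  | zero =>
    simpa [arch] using arch_norm hI hb hq 1 t
  | succ k ih =>
    have h1 : NormLe P (fun ω => ∑ j ∈ Finset.Icc 1 p,
        b j t * (arch p b (fun s ω => φ (z s ω)) (k + 1) (t - (j : ℤ)) ω -
          arch p b (fun s ω => φ (z s ω)) k (t - (j : ℤ)) ω))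
        (∑ j ∈ Finset.Icc 1 p, b j t * (A * q ^ k)) := by
      refine NormLe.sum _ (fun j hj => (ih _).const_mul (hb.nonneg' hj t))
        fun j hj => mul_nonneg (hb.nonneg' hj t) (by positivity)
    refine ((hI.mul_past (t := t) ?_ h1).mono ?_).congr (Eventually.of_forall fun ω => ?_)
    · refine Finset.measurable_sum _ fun j hj => Measurable.const_mul (Measurable.sub ?_ ?_) _ <;>
      exact measurable_arch_past hI.measurable_fun _ (by have := Finset.mem_Icc.1 hj; omega)
    · refine (hb.sum_mul_le (by positivity) t).trans_eq (by ring)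
    · simp only [mul_sub, Finset.sum_sub_distrib]
      rw [arch.eq_2 (k := k + 1), arch.eq_2 (k := k)]
      ring

/-- Telescoping; the geometric series accounts for the second factor `1 / (1 - q)`. -/
theorem arch_sub_norm [IsProbabilityMeasure P] (hI : Innov P z φ κ) (hb : Coef p κ R q b)
    (hq0 : 0 ≤ q) (hq : q < 1) {k l : ℕ} (hkl : k ≤ l) (t : ℤ) :
    NormLe P (fun ω => arch p b (fun s ω => φ (z s ω)) l t ω -
      arch p b (fun s ω => φ (z s ω)) k t ω) (κ * R / (1 - q) ^ 2 * q ^ k) := by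
  have hA : 0 ≤ κ * R / (1 - q) :=
    div_nonneg (mul_nonneg hI.pos hb.R_nonneg) (by linarith)
  have hq' : 0 < 1 - q := by linarith
  obtain ⟨m, rfl⟩ := Nat.exists_eq_add_of_le hkl
  have h : NormLe P (fun ω => arch p b (fun s ω => φ (z s ω)) (k + m) t ω -
      arch p b (fun s ω => φ (z s ω)) k t ω)
      (∑ i ∈ Finset.range m, κ * R / (1 - q) * q ^ (k + i)) := by
    refine (NormLe.sum (Finset.range m) (fun i _ => arch_succ_sub_norm hI hb hq0 hq (k + i) t)
      fun i _ => by positivity).congr (Eventually.of_forall fun ω => ?_)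
    exact (Finset.sum_range_sub (fun i => arch p b (fun s ω => φ (z s ω)) (k + i) t ω) m).symm
  refine h.mono ?_
  have h2 : ∑ i ∈ Finset.range m, q ^ i ≤ 1 / (1 - q) := by
    have := Summable.sum_le_tsum (Finset.range m) (fun i _ => pow_nonneg hq0 i)
      (summable_geometric_of_lt_one hq0 hq)
    rwa [tsum_geometric_of_lt_one hq0 hq, ← one_div] at this
  calc ∑ i ∈ Finset.range m, κ * R / (1 - q) * q ^ (k + i)
      = κ * R / (1 - q) * q ^ k * ∑ i ∈ Finset.range m, q ^ i := by
        rw [Finset.mul_sum]; exact Finset.sum_congr rfl fun i _ => by rw [pow_add]; ring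
    _ ≤ κ * R / (1 - q) * q ^ k * (1 / (1 - q)) := by gcongr
    _ = _ := by field_simp

/-- The causal solution of the squared ARCH recursion, the limit of the Picard iterates. -/
def archLim (p : ℕ) (b : ℕ → ℤ → ℝ) (w : ℤ → Ω → ℝ) (t : ℤ) (ω : Ω) : ℝ :=
  limUnder atTop fun k => arch p b w k t ω

theorem tendsto_arch [IsProbabilityMeasure P] (hI : Innov P z φ κ) (hb : Coef p κ R q b)
    (hq0 : 0 ≤ q) (hq : q < 1) (t : ℤ) :
    ∀ᵐ ω ∂P, Tendsto (fun k => arch p b (fun s ω => φ (z s ω)) k t ω) atTop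
      (𝓝 (archLim p b (fun s ω => φ (z s ω)) t ω)) := by
  have hA : 0 ≤ κ * R / (1 - q) ^ 2 :=
    div_nonneg (mul_nonneg hI.pos hb.R_nonneg) (by positivity)
  set A := κ * R / (1 - q) ^ 2 with hAdef
  -- The Cauchy criterion wants a strict, summable bound. A rate `q'` that is positive even if `q =
  -- 0`, together with the `+ 1` in `2 * A + 1`, makes the inequality strict.
  set q' := (1 + q) / 2 with hq'
  have hqq : q < q' := by rw [hq']; linarith
  have hq'1 : q' < 1 := by rw [hq']; linarith
  have hq'0 : 0 < q' := by linarith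
  have hsum : Summable fun k : ℕ => (2 * A + 1) * q' ^ k :=
    (summable_geometric_of_lt_one hq'0.le hq'1).mul_left _
  have := Lp.ae_tendsto_of_cauchy_eLpNorm (p := 2) (μ := P)
    (f := fun k => arch p b (fun s ω => φ (z s ω)) k t)
    (B := fun k => ENNReal.ofReal ((2 * A + 1) * q' ^ k))
    (fun k => (hI.measurable_arch k t).aestronglyMeasurable) (by norm_num)
    hsum.tsum_ofReal_ne_top ?_
  · filter_upwards [this] with ω hω
    exact tendsto_nhds_limUnder hω
  · intro N n m hn hm
    have h1 := (arch_sub_norm hI hb hq0 hq hn t).sub (arch_sub_norm hI hb hq0 hq hm t)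
      (by positivity) (by positivity)
    have h2 : eLpNorm (arch p b (fun s ω => φ (z s ω)) n t -
        arch p b (fun s ω => φ (z s ω)) m t) 2 P ≤ ENNReal.ofReal (A * q ^ N + A * q ^ N) := by
      refine le_trans (le_of_eq ?_) h1.2
      congr 1
      ext ω
      simp
    refine h2.trans_lt ((ENNReal.ofReal_lt_ofReal_iff (by positivity)).2 ?_)
    have h3 : q ^ N ≤ q' ^ N := pow_le_pow_left₀ hq0 hqq.le N
    have h4 : 0 < q' ^ N := by positivity
    nlinarith

theorem archLim_sub_norm [IsProbabilityMeasure P] (hI : Innov P z φ κ) (hb : Coef p κ R q b)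
    (hq0 : 0 ≤ q) (hq : q < 1) (k : ℕ) (t : ℤ) :
    NormLe P (fun ω => archLim p b (fun s ω => φ (z s ω)) t ω -
      arch p b (fun s ω => φ (z s ω)) k t ω) (κ * R / (1 - q) ^ 2 * q ^ k) := by
  refine NormLe.of_tendsto
    (f := fun l ω => arch p b (fun s ω => φ (z s ω)) l t ω - arch p b (fun s ω => φ (z s ω)) k t ω)
    (eventually_atTop.2 ⟨k, fun l hl => arch_sub_norm hI hb hq0 hq hl t⟩)
    (fun l => ((hI.measurable_arch l t).sub (hI.measurable_arch k t)).aestronglyMeasurable) ?_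
  filter_upwards [tendsto_arch hI hb hq0 hq t] with ω hω
  exact hω.sub_const _

theorem archLim_norm [IsProbabilityMeasure P] (hI : Innov P z φ κ) (hb : Coef p κ R q b)
    (hq0 : 0 ≤ q) (hq : q < 1) (t : ℤ) :
    NormLe P (archLim p b (fun s ω => φ (z s ω)) t) (κ * R / (1 - q)) :=
  NormLe.of_tendsto (Eventually.of_forall fun l => arch_norm hI hb hq l t)
    (fun l => (hI.measurable_arch l t).aestronglyMeasurable) (tendsto_arch hI hb hq0 hq t)

theorem archLim_eq [IsProbabilityMeasure P] (hI : Innov P z φ κ) (hb : Coef p κ R q b)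
    (hq0 : 0 ≤ q) (hq : q < 1) :
    ∀ᵐ ω ∂P, ∀ t, archLim p b (fun s ω => φ (z s ω)) t ω = φ (z t ω) *
      (b 0 t + ∑ j ∈ Finset.Icc 1 p, b j t *
        archLim p b (fun s ω => φ (z s ω)) (t - (j : ℤ)) ω) := by
  filter_upwards [ae_all_iff.2 fun t => tendsto_arch hI hb hq0 hq t] with ω hω t
  refine tendsto_nhds_unique ((tendsto_add_atTop_iff_nat 1).2 (hω t)) ?_
  simp only [arch]
  exact (tendsto_const_nhds.add (tendsto_finsetSum _ fun j _ => (hω _).const_mul _)).const_mul _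

end arch

/-! ### Boundedness in probability -/

/-- The family `f` is bounded in probability. -/
def TightFam {ι : Type*} (P : Measure Ω) (f : ι → Ω → ℝ) : Prop :=
  ∀ ε : ℝ, 0 < ε → ∃ C : ℝ, ∀ i, P.real {ω | C < |f i ω|} ≤ ε

namespace TightFam

variable {ι : Type*} {f g : ι → Ω → ℝ}

theorem add [IsFiniteMeasure P] (hf : TightFam P f) (hg : TightFam P g) :
    TightFam P fun i ω => f i ω + g i ω := by
  intro ε hε
  obtain ⟨C, hC⟩ := hf (ε / 2) (by positivity)
  obtain ⟨D, hD⟩ := hg (ε / 2) (by positivity)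
  refine ⟨C + D, fun i => ?_⟩
  calc P.real {ω | C + D < |f i ω + g i ω|}
      ≤ P.real ({ω | C < |f i ω|} ∪ {ω | D < |g i ω|}) := by
        refine measureReal_mono fun ω hω => ?_
        by_contra hcon
        simp only [mem_union, mem_ofPred_eq, not_or, not_lt] at hcon hω
        linarith [abs_add_le (f i ω) (g i ω)]
    _ ≤ _ := (measureReal_union_le _ _).trans (by linarith [hC i, hD i])

theorem const [IsFiniteMeasure P] (c : ℝ) : TightFam P fun (_ : ι) (_ : Ω) => c :=
  fun ε hε => ⟨|c|, fun i => by simpa using hε.le⟩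

theorem sum [IsFiniteMeasure P] {κ : Type*} (s : Finset κ) {f : κ → ι → Ω → ℝ}
    (hf : ∀ j ∈ s, TightFam P (f j)) : TightFam P fun i ω => ∑ j ∈ s, f j i ω := by
  classical
  induction s using Finset.induction_on with
  | empty => simpa using TightFam.const 0
  | insert j s hj ih =>
    simp only [Finset.sum_insert hj]
    exact (hf j (by simp)).add (ih fun k hk => hf k (by simp [hk]))

theorem abs (hf : TightFam P f) : TightFam P fun i ω => |f i ω| := by
  simpa [TightFam] using hf

theorem sub [IsFiniteMeasure P] (hf : TightFam P f) (hg : TightFam P g) :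
    TightFam P fun i ω => f i ω - g i ω := by
  have h : TightFam P fun i ω => - g i ω := by simpa [TightFam] using hg
  simpa [sub_eq_add_neg] using hf.add h

theorem sq [IsFiniteMeasure P] (hf : TightFam P f) : TightFam P fun i ω => f i ω ^ 2 := by
  intro ε hε
  obtain ⟨C, hC⟩ := hf ε hε
  refine ⟨C ^ 2, fun i => (measureReal_mono fun ω hω => ?_).trans (hC i)⟩
  have h : C ^ 2 < |f i ω ^ 2| := hω
  rw [abs_pow, sq_lt_sq, abs_abs] at h
  exact (le_abs_self C).trans_lt h

theorem comp {κ : Type*} (hf : TightFam P f) (e : κ → ι) : TightFam P fun i => f (e i) :=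
  fun ε hε => (hf ε hε).imp fun _ h i => h (e i)

theorem of_normLe [IsProbabilityMeasure P] {c : ℝ} (hc : 0 ≤ c) (h : ∀ i, NormLe P (f i) c) :
    TightFam P f := by
  intro ε hε
  refine ⟨(c + 1) / ε, fun i => ?_⟩
  refine (ENNReal.toReal_le_of_le_ofReal (by positivity)
    ((h i).measure_lt_le hc (C := (c + 1) / ε) (by positivity))).trans ?_
  rw [div_div_eq_mul_div, div_le_iff₀ (by positivity)]
  nlinarith

end TightFam

/-- A product of a family bounded in probability and a family that tends to `0` in mean tends
to `0` in probability. -/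
theorem tendstoInMeasure_of_le_mul [IsProbabilityMeasure P] {f M L : ℕ → Ω → ℝ} {g : Ω → ℝ}
    {c : ℕ → ℝ} (hM : TightFam P M) (hLi : ∀ᶠ n in atTop, Integrable (L n) P)
    (hL : ∀ᶠ n in atTop, ∫ ω, |L n ω| ∂P ≤ c n) (hc : Tendsto c atTop (𝓝 0))
    (hf : ∀ᶠ n in atTop, ∀ᵐ ω ∂P, |f n ω - g ω| ≤ |M n ω| * |L n ω|) :
    TendstoInMeasure P f atTop g := by
  rw [tendstoInMeasure_iff_measureReal_norm]
  intro ε hε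
  refine Metric.tendsto_nhds.2 fun η hη => ?_
  obtain ⟨C, hC⟩ := hM (η / 2) (by positivity)
  -- Off the event `C < |M n|` the error is at most `D |L n|`, with `D` positive so that Markov's
  -- inequality can be applied at level `ε / D`.
  set D := max C 1 with hD
  have hD0 : 0 < D := lt_of_lt_of_le one_pos (le_max_right _ _)
  have h1 : ∀ᶠ n in atTop, c n < ε * η / (2 * D) := hc.eventually_lt_const (by positivity)
  filter_upwards [hLi, hL, hf, h1] with n hn1 hn2 hn3 hn4
  rw [Real.dist_0_eq_abs, abs_of_nonneg measureReal_nonneg]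
  have h2 : P.real {ω | ε ≤ ‖f n ω - g ω‖}
      ≤ P.real ({ω | C < |M n ω|} ∪ {ω | ε / D ≤ |L n ω|}) := by
    refine ENNReal.toReal_mono (measure_ne_top _ _) (measure_mono_ae ?_)
    filter_upwards [hn3] with ω hω h
    by_contra hcon
    have hcon' : ¬ (C < |M n ω| ∨ ε / D ≤ |L n ω|) := hcon
    rw [not_or, not_lt, not_le, lt_div_iff₀ hD0] at hcon'
    have h' : ε ≤ |f n ω - g ω| := h
    have : |M n ω| ≤ D := hcon'.1.trans (le_max_left _ _)
    nlinarith [abs_nonneg (L n ω)]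
  have h3 := mul_meas_ge_le_integral_of_nonneg (μ := P) (f := fun ω => |L n ω|)
    (Eventually.of_forall fun _ => abs_nonneg _) hn1.abs (ε / D)
  have h4 : P.real {ω | ε / D ≤ |L n ω|} < η / 2 := by
    have h5 : ε / D * P.real {ω | ε / D ≤ |L n ω|} < ε / D * (η / 2) := by
      refine (h3.trans hn2).trans_lt (hn4.trans_eq ?_)
      field_simp
    exact lt_of_mul_lt_mul_left h5 (by positivity)
  linarith [measureReal_union_le (μ := P) {ω | C < |M n ω|} {ω | ε / D ≤ |L n ω|}, hC n]

/-! ### Forgetting of the initial values and uniqueness of the solution -/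

/-- Iterates of the homogeneous recursion `L_t = w_t ∑_j b_j(t) L_{t-j}`, `t > s`, with initial
values `L_t = 1`, `t ≤ s`. -/
def decayRec (p : ℕ) (b : ℕ → ℤ → ℝ) (w : ℤ → Ω → ℝ) (s : ℤ) : ℕ → ℤ → Ω → ℝ
  | 0, _, _ => 1
  | k + 1, t, ω => if t ≤ s then 1 else
      w t ω * ∑ j ∈ Finset.Icc 1 p, b j t * decayRec p b w s k (t - (j : ℤ)) ω

section decay

variable {p : ℕ} {b : ℕ → ℤ → ℝ} {κ R q r : ℝ} {z : ℤ → Ω → ℝ} {φ : ℝ → ℝ}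

theorem decayRec_succ_of_le (w : ℤ → Ω → ℝ) {s t : ℤ} (h : t ≤ s) (k : ℕ) :
    decayRec p b w s (k + 1) t = fun _ => 1 := by
  funext ω; simp [decayRec, h]

theorem decayRec_succ_of_lt (w : ℤ → Ω → ℝ) {s t : ℤ} (h : s < t) (k : ℕ) :
    decayRec p b w s (k + 1) t = fun ω =>
      w t ω * ∑ j ∈ Finset.Icc 1 p, b j t * decayRec p b w s k (t - (j : ℤ)) ω := by
  funext ω; simp [decayRec, h.not_ge]

theorem measurable_decayRec_sig (hφ : Measurable φ) (s : ℤ) (k : ℕ) (t : ℤ) :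
    Measurable[sig z (Iic t)] (decayRec p b (fun s ω => φ (z s ω)) s k t) := by
  induction k generalizing t with
  | zero => exact measurable_const
  | succ k ih =>
    rcases le_or_gt t s with h | h
    · rw [decayRec_succ_of_le _ h]; exact measurable_const
    · rw [decayRec_succ_of_lt _ h]
      refine Measurable.mul (hφ.comp (measurable_sig z (mem_Iic.2 le_rfl))) ?_
      refine Finset.measurable_sum _ fun j hj => Measurable.const_mul ?_ _
      exact (ih (t - j)).mono (sig_mono z (Iic_subset_Iic.2 (by omega))) le_rfl

/-- A step gains the factor `q ≤ r ^ p` and goes back at most `p` time units, which is a rate `r`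
per unit of time. For `t ≤ s` the exponent is nonpositive, so the bound covers the initial value
`1`. The restriction `t ≤ s + k` ensures that the `k` iterations reach the initial values. -/
theorem decayRec_norm [IsProbabilityMeasure P] (hI : Innov P z φ κ) (hb : Coef p κ R q b)
    (hr0 : 0 < r) (hr : r ≤ 1) (hqr : q ≤ r ^ p) (s : ℤ) (k : ℕ) (t : ℤ) (ht : t ≤ s + k) :
    NormLe P (decayRec p b (fun s ω => φ (z s ω)) s k t) (r ^ (t - s)) := by
  have hone : ∀ t ≤ s, (1 : ℝ) ≤ r ^ (t - s) := fun t h => one_le_zpow_of_nonpos₀ hr0 hr (by omega)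
  induction k generalizing t with
  | zero => exact (NormLe.const zero_le_one).mono (hone t (by simpa using ht))
  | succ k ih =>
    rcases le_or_gt t s with h | h
    · rw [decayRec_succ_of_le _ h]; exact (NormLe.const zero_le_one).mono (hone t h)
    · rw [decayRec_succ_of_lt _ h]
      have h1 : NormLe P (fun ω => ∑ j ∈ Finset.Icc 1 p, b j t *
          decayRec p b (fun s ω => φ (z s ω)) s k (t - (j : ℤ)) ω)
          (∑ j ∈ Finset.Icc 1 p, b j t * r ^ (t - s - p)) := by
        refine NormLe.sum _ (fun j hj => ?_) fun j hj => mul_nonneg (hb.nonneg' hj t) (by positivity)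
        rw [Finset.mem_Icc] at hj
        refine ((ih (t - j) (by push_cast at ht; omega)).mono ?_).const_mul (hb.nonneg j hj.2 t)
        exact zpow_le_zpow_right_of_le_one₀ hr0 hr (by omega)
      refine (hI.mul_past (t := t) ?_ h1).mono ?_
      · refine Finset.measurable_sum _ fun j hj => Measurable.const_mul ?_ _
        have := Finset.mem_Icc.1 hj
        exact (measurable_decayRec_sig hI.measurable_fun s k (t - j)).mono
          (sig_mono z (Iic_subset_Iio.2 (by omega))) le_rfl
      · refine (hb.sum_mul_le (by positivity) t).trans ?_
        calc q * r ^ (t - s - p) ≤ r ^ p * r ^ (t - s - p) := by gcongr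
          _ = r ^ (t - s) := by
            rw [← zpow_natCast, ← zpow_add₀ hr0.ne']; congr 1; ring

/-- The intercepts cancel, so the difference of two solutions obeys the homogeneous recursion, with
nonnegative coefficients. The comparison is made for a fixed `ω`: neither integrability nor
causality of the two solutions is needed, and `M` may be random. -/
theorem abs_sub_le_decayRec (hb : Coef p κ R q b) {w : ℤ → Ω → ℝ} {ω : Ω} (hw : ∀ t, 0 ≤ w t ω)
    {s T : ℤ} {y y' : ℤ → ℝ} {M : ℝ}
    (hy : ∀ t, s < t → t ≤ T →
      y t = w t ω * (b 0 t + ∑ j ∈ Finset.Icc 1 p, b j t * y (t - (j : ℤ))))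
    (hy' : ∀ t, s < t → t ≤ T →
      y' t = w t ω * (b 0 t + ∑ j ∈ Finset.Icc 1 p, b j t * y' (t - (j : ℤ))))
    (hM : ∀ t, s - p < t → t ≤ s → |y t - y' t| ≤ M) (k : ℕ) (t : ℤ) (ht : s - p < t) (htT : t ≤ T)
    (htk : t ≤ s + k) : |y t - y' t| ≤ M * decayRec p b w s k t ω := by
  induction k generalizing t with
  | zero => simpa [decayRec] using hM t ht (by simpa using htk)
  | succ k ih =>
    rcases le_or_gt t s with h | h
    · simpa [decayRec_succ_of_le _ h] using hM t ht h
    · rw [hy t h htT, hy' t h htT, decayRec_succ_of_lt _ h]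
      have h1 : w t ω * (b 0 t + ∑ j ∈ Finset.Icc 1 p, b j t * y (t - (j : ℤ))) -
          w t ω * (b 0 t + ∑ j ∈ Finset.Icc 1 p, b j t * y' (t - (j : ℤ))) =
          w t ω * ∑ j ∈ Finset.Icc 1 p, b j t * (y (t - (j : ℤ)) - y' (t - (j : ℤ))) := by
        simp only [mul_sub, Finset.sum_sub_distrib]; ring
      rw [h1, abs_mul, abs_of_nonneg (hw t), mul_left_comm, Finset.mul_sum]
      refine mul_le_mul_of_nonneg_left ?_ (hw t)
      refine (Finset.abs_sum_le_sum_abs _ _).trans (Finset.sum_le_sum fun j hj => ?_)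
      rw [abs_mul, abs_of_nonneg (hb.nonneg' hj t), mul_left_comm]
      rw [Finset.mem_Icc] at hj
      exact mul_le_mul_of_nonneg_left
        (ih (t - j) (by omega) (by omega) (by push_cast at htk; omega)) (hb.nonneg j hj.2 t)

theorem abs_sub_le_sum (y y' : ℤ → ℝ) {s : ℤ} (t : ℤ) (ht : s - p < t) (hts : t ≤ s) :
    |y t - y' t| ≤ ∑ i ∈ Finset.range p, |y (s - (i : ℤ)) - y' (s - (i : ℤ))| := by
  obtain ⟨i, hi⟩ := Int.eq_ofNat_of_zero_le (show 0 ≤ s - t by omega)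
  have h := Finset.single_le_sum (f := fun i : ℕ => |y (s - (i : ℤ)) - y' (s - (i : ℤ))|)
    (fun i _ => abs_nonneg _) (Finset.mem_range.2 (show i < p by omega))
  simpa [show s - (i : ℤ) = t by omega] using h

/-- The causal solution is the only solution on `ℤ` that is bounded in probability. -/
theorem ae_eq_archLim [IsProbabilityMeasure P] (hI : Innov P z φ κ) (hb : Coef p κ R q b)
    (hq0 : 0 ≤ q) (hq : q < 1) (hr0 : 0 < r) (hr : r < 1) (hqr : q ≤ r ^ p) {Y : ℤ → Ω → ℝ}
    (hY : ∀ t, ∀ᵐ ω ∂P, Y t ω = φ (z t ω) *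
      (b 0 t + ∑ j ∈ Finset.Icc 1 p, b j t * Y (t - (j : ℤ)) ω))
    (hYm : ∀ t, Measurable (Y t)) (hYt : TightFam P Y) (t : ℤ) :
    Y t =ᵐ[P] archLim p b (fun s ω => φ (z s ω)) t := by
  have hR := hb.R_nonneg
  have hA : 0 ≤ κ * R / (1 - q) := div_nonneg (mul_nonneg hI.pos hR) (by linarith)
  have htl : TightFam P (archLim p b fun s ω => φ (z s ω)) :=
    TightFam.of_normLe hA fun t => archLim_norm hI hb hq0 hq t
  -- Restart both solutions at time `t - n`. Their discrepancy there is bounded in probability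
  -- uniformly in `n`, while its influence at time `t` has norm at most `r ^ n`. Hence the constant
  -- sequence `Y t` converges in probability to the causal solution.
  have h1 : TendstoInMeasure P (fun _ : ℕ => Y t) atTop
      (archLim p b (fun s ω => φ (z s ω)) t) := by
    refine tendstoInMeasure_of_le_mul
      (M := fun n ω => ∑ i ∈ Finset.range p, |Y (t - (n : ℤ) - (i : ℤ)) ω -
        archLim p b (fun s ω => φ (z s ω)) (t - (n : ℤ) - (i : ℤ)) ω|)
      (L := fun n => decayRec p b (fun s ω => φ (z s ω)) (t - n) n t) (c := fun n => r ^ n)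
      ?_ ?_ ?_ (tendsto_pow_atTop_nhds_zero_of_lt_one hr0.le hr) ?_
    · exact TightFam.sum _ fun i _ => ((hYt.comp _).sub (htl.comp _)).abs
    · exact Eventually.of_forall fun n =>
        (decayRec_norm hI hb hr0 hr.le hqr (t - n) n t (by omega)).integrable
    · refine Eventually.of_forall fun n => ?_
      have := (decayRec_norm hI hb hr0 hr.le hqr (t - n) n t (by omega)).integral_abs_le
        (by positivity)
      simpa using this
    · filter_upwards [eventually_ge_atTop 1] with n hn
      filter_upwards [ae_all_iff.2 hY, archLim_eq hI hb hq0 hq] with ω hω1 hω2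
      rw [← abs_mul]
      exact (abs_sub_le_decayRec (T := t) hb (w := fun s ω => φ (z s ω)) (ω := ω)
        (fun t => hI.nonneg _) (s := t - n) (y := fun s => Y s ω)
        (y' := fun s => archLim p b (fun s ω => φ (z s ω)) s ω) (fun t _ _ => hω1 t)
        (fun t _ _ => hω2 t) (fun u hu hu' => abs_sub_le_sum (fun s => Y s ω)
          (fun s => archLim p b (fun s ω => φ (z s ω)) s ω) u hu hu') n t
        (by omega) le_rfl (by omega)).trans (le_abs_self _)
  exact tendstoInMeasure_ae_unique (f := fun _ : ℕ => Y t) (u := atTop)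
    (tendstoInMeasure_of_tendsto_ae (fun _ => (hYm t).aestronglyMeasurable)
      (Eventually.of_forall fun _ => tendsto_const_nhds)) h1

end decay

/-! ### Perturbation of coefficients and innovations -/

theorem NormLe.const_abs [IsProbabilityMeasure P] (a : ℝ) : NormLe P (fun _ => a) |a| :=
  (NormLe.const (abs_nonneg a)).of_abs_le aestronglyMeasurable_const (by simp)

theorem NormLe.const_mul_abs {f : Ω → ℝ} {c : ℝ} (hf : NormLe P f c) (a : ℝ) :
    NormLe P (fun ω => a * f ω) (|a| * c) :=
  (hf.const_mul (abs_nonneg a)).of_abs_le (hf.1.const_mul a) (by simp [abs_mul])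

section perturb

variable {p : ℕ} {b b' : ℕ → ℤ → ℝ} {κ R q τ η : ℝ} {z : ℤ → Ω → ℝ} {φ φ' : ℝ → ℝ}

/-- Stability of the Picard iterates under perturbations of the coefficients, on the window of
times on which they depend, and of the innovations. -/
theorem arch_perturb [IsProbabilityMeasure P] (hI : Innov P z φ κ) (hI' : Innov P z φ' κ)
    (hτ : ∀ t, NormLe P (fun ω => φ (z t ω) - φ' (z t ω)) τ) (hτ0 : 0 ≤ τ)
    (hb : Coef p κ R q b) (hb' : Coef p κ R q b') (hq : q < 1) (hη : 0 ≤ η)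
    (k : ℕ) (t : ℤ)
    (h : ∀ s, t - k * p ≤ s → s ≤ t → ∀ j ≤ p, |b j s - b' j s| ≤ η) :
    NormLe P (fun ω => arch p b (fun s ω => φ (z s ω)) k t ω -
      arch p b' (fun s ω => φ' (z s ω)) k t ω)
      ((τ * (R + κ * R / (1 - q)) + κ * (η * (1 + p * (κ * R / (1 - q))))) / (1 - q)) := by
  have hR := hb.R_nonneg
  have hκ := hI.pos
  have hq' : 0 < 1 - q := by linarith
  have hA : 0 ≤ κ * R / (1 - q) := by positivity
  set A := κ * R / (1 - q) with hAdef
  -- `E` solves `E = τ (R + A) + κ η (1 + p A) + q E`. The terms come from exchanging `φ` for `φ'`,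
  -- then `b` for `b'`, and last the previous iterates, where the contraction acts.
  set E := (τ * (R + A) + κ * (η * (1 + p * A))) / (1 - q) with hE
  have hE0 : 0 ≤ E := by positivity
  induction k generalizing t with
  | zero => simpa [arch] using (NormLe.zero (P := P)).mono hE0
  | succ k ih =>
    set x : ℤ → Ω → ℝ := fun s => arch p b (fun s ω => φ (z s ω)) k s with hx
    set x' : ℤ → Ω → ℝ := fun s => arch p b' (fun s ω => φ' (z s ω)) k s with hx'
    have hpast : ∀ j ∈ Finset.Icc 1 p, Measurable[sig z (Iio t)] (x (t - (j : ℤ))) ∧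
        Measurable[sig z (Iio t)] (x' (t - (j : ℤ))) := fun j hj => by
      have := Finset.mem_Icc.1 hj
      exact ⟨measurable_arch_past hI.measurable_fun k (by omega),
        measurable_arch_past hI'.measurable_fun k (by omega)⟩
    have hwin : ∀ j ≤ p, |b j t - b' j t| ≤ η :=
      h t (by nlinarith [Int.natCast_nonneg p, Int.natCast_nonneg (k + 1)]) le_rfl
    have h1 : NormLe P (fun ω => b 0 t + ∑ j ∈ Finset.Icc 1 p, b j t * x (t - (j : ℤ)) ω)
        (R + A) := by
      have h0 : ∑ j ∈ Finset.Icc 1 p, b j t * A ≤ A := by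
        rw [← Finset.sum_mul]
        exact mul_le_of_le_one_left hA (hb.sum_le t)
      refine ((NormLe.const (hb.nonneg 0 (Nat.zero_le _) t)).add
        (NormLe.sum _ (fun j hj => (arch_norm hI hb hq k _).const_mul (hb.nonneg' hj t)) ?_)
        (hb.nonneg 0 (Nat.zero_le _) t) ?_).mono (add_le_add (hb.zero_le t) h0)
      · exact fun j hj => mul_nonneg (hb.nonneg' hj t) hA
      · exact Finset.sum_nonneg fun j hj => mul_nonneg (hb.nonneg' hj t) hA
    have h2 : NormLe P (fun ω => (φ (z t ω) - φ' (z t ω)) *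
        (b 0 t + ∑ j ∈ Finset.Icc 1 p, b j t * x (t - (j : ℤ)) ω)) (τ * (R + A)) := by
      have hm : Measurable[sig z (Iio t)]
          fun ω => b 0 t + ∑ j ∈ Finset.Icc 1 p, b j t * x (t - (j : ℤ)) ω :=
        Measurable.const_add (Finset.measurable_sum _ fun j hj => (hpast j hj).1.const_mul _) _
      refine (hτ t).mul_of_indepFun h1 hτ0
        ((hI.measurable_innov t).sub (hI'.measurable_innov t))
        (hm.mono (sig_le hI.measurable _) le_rfl)
        (indepFun_of_disjoint hI.measurable hI.indep (S := {t}) (T := Iio t) (by simp) ?_ hm)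
      exact (hI.measurable_fun.comp (measurable_sig z (mem_singleton t))).sub
        (hI'.measurable_fun.comp (measurable_sig z (mem_singleton t)))
    have h3 : NormLe P (fun ω => (b 0 t - b' 0 t) + ∑ j ∈ Finset.Icc 1 p,
        ((b j t - b' j t) * x (t - (j : ℤ)) ω +
          b' j t * (x (t - (j : ℤ)) ω - x' (t - (j : ℤ)) ω)))
        (η + ∑ j ∈ Finset.Icc 1 p, (η * A + b' j t * E)) := by
      refine ((NormLe.const_abs _).mono (hwin 0 (Nat.zero_le _))).add
        (NormLe.sum _ (fun j hj => ?_) fun j hj => ?_) hη (Finset.sum_nonneg fun j hj => ?_)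
      · rw [Finset.mem_Icc] at hj
        refine NormLe.add ((arch_norm hI hb hq k _).const_mul_abs _ |>.mono ?_)
          ((ih _ fun s hs hs' => h s ?_ ?_).const_mul (hb'.nonneg j hj.2 t)) (by positivity)
          (mul_nonneg (hb'.nonneg j hj.2 t) hE0)
        · exact mul_le_mul_of_nonneg_right (hwin j hj.2) hA
        · push_cast; nlinarith
        · omega
      all_goals exact add_nonneg (by positivity) (mul_nonneg (hb'.nonneg' hj t) hE0)
    have h4 := hI'.mul_past (t := t) (Measurable.const_add (Finset.measurable_sum _ fun j hj =>
      ((hpast j hj).1.const_mul _).add (((hpast j hj).1.sub (hpast j hj).2).const_mul _)) _) h3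
    have hS : 0 ≤ ∑ j ∈ Finset.Icc 1 p, (η * A + b' j t * E) := Finset.sum_nonneg fun j hj =>
      add_nonneg (by positivity) (mul_nonneg (hb'.nonneg' hj t) hE0)
    refine ((h2.add h4 (by positivity) (by positivity)).mono ?_).congr
      (Eventually.of_forall fun ω => ?_)
    · have h5 := hb'.sum_mul_le hE0 t
      have h6 : E * (1 - q) = τ * (R + A) + κ * (η * (1 + p * A)) := by
        rw [hE]; field_simp
      have h7 : ∑ j ∈ Finset.Icc 1 p, (η * A + b' j t * E) =
          p * (η * A) + ∑ j ∈ Finset.Icc 1 p, b' j t * E := by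
        rw [Finset.sum_add_distrib]; simp
      rw [h7]
      linarith
    · have h8 : ∑ j ∈ Finset.Icc 1 p, ((b j t - b' j t) * x (t - (j : ℤ)) ω +
          b' j t * (x (t - (j : ℤ)) ω - x' (t - (j : ℤ)) ω)) =
          ∑ j ∈ Finset.Icc 1 p, b j t * x (t - (j : ℤ)) ω -
            ∑ j ∈ Finset.Icc 1 p, b' j t * x' (t - (j : ℤ)) ω := by
        rw [← Finset.sum_sub_distrib]
        exact Finset.sum_congr rfl fun j _ => by ring
      simp only [Pi.add_apply, Pi.sub_apply]
      rw [h8, arch_succ, arch_succ]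
      ring

/-- Bounded innovations need not contract in the supremum norm, so `D` may grow with `k`. What
matters is that it is uniform in the coefficients, the time and `ω`. -/
theorem arch_bounded (p : ℕ) (R κ q : ℝ) {B : ℝ} (hB : 0 ≤ B) (k : ℕ) :
    ∃ D : ℝ, 0 ≤ D ∧ ∀ b, Coef p κ R q b → ∀ w : ℤ → Ω → ℝ, (∀ t ω, 0 ≤ w t ω) →
      (∀ t ω, w t ω ≤ B) → ∀ t ω, |arch p b w k t ω| ≤ D := by
  induction k with
  | zero => exact ⟨0, le_rfl, fun b _ w _ _ t ω => by simp [arch]⟩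
  | succ k ih =>
    obtain ⟨D, hD, h⟩ := ih
    refine ⟨B * (|R| + D), by positivity, fun b hb w hw hwB t ω => ?_⟩
    have h1 : ∑ j ∈ Finset.Icc 1 p, b j t * arch p b w k (t - (j : ℤ)) ω ≤ D := by
      calc _ ≤ ∑ j ∈ Finset.Icc 1 p, b j t * D := Finset.sum_le_sum fun j hj =>
            mul_le_mul_of_nonneg_left ((le_abs_self _).trans (h b hb w hw hwB _ _))
              (hb.nonneg' hj t)
        _ ≤ D := by rw [← Finset.sum_mul]; exact mul_le_of_le_one_left hD (hb.sum_le t)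
    rw [abs_of_nonneg (arch_nonneg hb hw (k + 1) t ω), arch_succ]
    have h2 : b 0 t + ∑ j ∈ Finset.Icc 1 p, b j t * arch p b w k (t - (j : ℤ)) ω ≤ |R| + D :=
      add_le_add ((hb.zero_le t).trans (le_abs_self R)) h1
    exact (mul_le_mul_of_nonneg_left h2 (hw t ω)).trans
      (mul_le_mul_of_nonneg_right (hwB t ω) (by positivity))

end perturb

/-! ### Truncation and a weak law for finitely dependent arrays -/

/-- Truncation of a square integrable variable. -/
theorem exists_truncation {f : Ω → ℝ} (hf : MemLp f 2 P) (hfm : Measurable f)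
    (hf0 : ∀ ω, 0 ≤ f ω) {τ : ℝ}
    (hτ : 0 < τ) : ∃ B : ℝ, 0 ≤ B ∧ NormLe P (fun ω => f ω - min (f ω) B) τ := by
  obtain ⟨B, hB0, hB⟩ := hf.eLpNorm_indicator_norm_ge_pos_le hfm.stronglyMeasurable hτ
  refine ⟨B, hB0.le, hf.1.sub (hf.1.inf aestronglyMeasurable_const), le_trans ?_ hB⟩
  refine eLpNorm_mono_ae (Eventually.of_forall fun ω => ?_)
  by_cases h : B ≤ f ω
  · rw [indicator_of_mem (by simpa [abs_of_nonneg (hf0 ω)] using h), min_eq_right h,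
      Real.norm_of_nonneg (by linarith), Real.norm_of_nonneg (hf0 ω)]
    linarith
  · rw [min_eq_left (le_of_not_ge h)]
    simp

theorem NormLe.of_variance_le [IsProbabilityMeasure P] {f : Ω → ℝ} (hf : MemLp f 2 P) {c : ℝ}
    (hc : 0 ≤ c) (h : Var[f; P] ≤ c ^ 2) : NormLe P (fun ω => f ω - ∫ ω, f ω ∂P) c := by
  have hm : MemLp (fun ω => f ω - ∫ ω, f ω ∂P) 2 P := hf.sub (memLp_const _)
  refine ⟨hm.1, ?_⟩
  rw [hm.eLpNorm_eq_integral_rpow_norm (by norm_num) (by norm_num)]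
  refine ENNReal.ofReal_le_ofReal ?_
  rw [variance_eq_integral hf.1.aemeasurable] at h
  simp only [ENNReal.toReal_ofNat, Real.norm_eq_abs, Real.rpow_two, sq_abs]
  calc _ ≤ (c ^ 2) ^ (2 : ℝ)⁻¹ := Real.rpow_le_rpow (integral_nonneg fun _ => sq_nonneg _) h
        (by norm_num)
    _ = c := by
      rw [← Real.rpow_natCast, ← Real.rpow_mul hc]; norm_num

/-- Fluctuations of a sum of bounded `m`-dependent variables. -/
theorem sum_sub_integral_norm [IsProbabilityMeasure P] {Q : ℤ → Ω → ℝ} {B : ℝ} (hB : 0 ≤ B)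
    {m n : ℕ} (hm : ∀ t ∈ Finset.Icc (1 : ℤ) n, Measurable (Q t))
    (hQ : ∀ t ∈ Finset.Icc (1 : ℤ) n, ∀ ω, |Q t ω| ≤ B)
    (hind : ∀ t ∈ Finset.Icc (1 : ℤ) n, ∀ t' ∈ Finset.Icc (1 : ℤ) n, t + m < t' →
      IndepFun (Q t) (Q t') P) :
    NormLe P (fun ω => ∑ t ∈ Finset.Icc (1 : ℤ) n, (Q t ω - ∫ ω, Q t ω ∂P))
      (√(n * ((2 * m + 1) * (2 * B) ^ 2))) := by
  have hL : ∀ t ∈ Finset.Icc (1 : ℤ) n, MemLp (Q t) 2 P := fun t ht =>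
    MemLp.of_bound (hm t ht).aestronglyMeasurable B (Eventually.of_forall (hQ t ht))
  have hint : ∀ t ∈ Finset.Icc (1 : ℤ) n, |∫ ω, Q t ω ∂P| ≤ B := fun t ht => by
    have := norm_integral_le_of_norm_le_const (μ := P) (f := Q t) (C := B)
      (Eventually.of_forall (hQ t ht))
    simpa using this
  have hcov : ∀ t ∈ Finset.Icc (1 : ℤ) n, ∀ t' ∈ Finset.Icc (1 : ℤ) n,
      cov[Q t, Q t'; P] ≤ if t' ∈ Finset.Icc (t - m) (t + m) then (2 * B) ^ 2 else 0 := by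
    intro t ht t' ht'
    split_ifs with h
    · refine (le_abs_self _).trans ?_
      have h1 : ∀ ω, ‖(Q t ω - ∫ ω, Q t ω ∂P) * (Q t' ω - ∫ ω, Q t' ω ∂P)‖ ≤ (2 * B) ^ 2 := by
        intro ω
        rw [norm_mul, sq]
        refine mul_le_mul ?_ ?_ (norm_nonneg _) (by positivity)
        · exact (norm_sub_le _ _).trans (by
            simp only [Real.norm_eq_abs]; linarith [hQ t ht ω, hint t ht])
        · exact (norm_sub_le _ _).trans (by
            simp only [Real.norm_eq_abs]; linarith [hQ t' ht' ω, hint t' ht'])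
      have := norm_integral_le_of_norm_le_const (μ := P) (Eventually.of_forall h1)
      simpa [covariance] using this
    · refine le_of_eq ?_
      rw [Finset.mem_Icc, not_and_or, not_le, not_le] at h
      rcases h with h | h
      · rw [covariance_comm]
        exact (hind t' ht' t ht (by omega)).covariance_eq_zero (hL t' ht') (hL t ht)
      · exact (hind t ht t' ht' h).covariance_eq_zero (hL t ht) (hL t' ht')
  -- For each `t` at most `2m + 1` times `t'` have a nonzero covariance with it, so the variance is
  -- linear in `n`.
  have hvar : Var[fun ω => ∑ t ∈ Finset.Icc (1 : ℤ) n, Q t ω; P] ≤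
      n * ((2 * m + 1) * (2 * B) ^ 2) := by
    rw [variance_fun_sum' hL]
    calc _ ≤ ∑ t ∈ Finset.Icc (1 : ℤ) n, ∑ t' ∈ Finset.Icc (1 : ℤ) n,
          (if t' ∈ Finset.Icc (t - m) (t + m) then (2 * B) ^ 2 else 0) :=
          Finset.sum_le_sum fun t ht => Finset.sum_le_sum fun t' ht' => hcov t ht t' ht'
      _ ≤ ∑ t ∈ Finset.Icc (1 : ℤ) n, ((2 * m + 1) * (2 * B) ^ 2) := by
          refine Finset.sum_le_sum fun t _ => ?_
          rw [← Finset.sum_filter, Finset.sum_const, nsmul_eq_mul]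
          refine mul_le_mul_of_nonneg_right ?_ (by positivity)
          have h1 : ((Finset.Icc (1 : ℤ) n).filter
              fun t' => t' ∈ Finset.Icc (t - m) (t + m)).card ≤ 2 * m + 1 := by
            refine (Finset.card_le_card (t := Finset.Icc (t - m) (t + m))
              fun x hx => (Finset.mem_filter.1 hx).2).trans ?_
            rw [Int.card_Icc]; omega
          exact_mod_cast h1
      _ = _ := by simp
  have := NormLe.of_variance_le (f := fun ω => ∑ t ∈ Finset.Icc (1 : ℤ) n, Q t ω)
    (memLp_finsetSum _ hL) (Real.sqrt_nonneg _) (hvar.trans_eq (Real.sq_sqrt (by positivity)).symm)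
  refine this.congr (Eventually.of_forall fun ω => ?_)
  simp only [Finset.sum_sub_distrib]
  rw [integral_finsetSum _ fun t ht => (hL t ht).integrable (by norm_num)]

/-- Weak law of large numbers for triangular arrays whose entries can be approximated in mean,
uniformly, by bounded `m`-dependent variables. -/
theorem tendsto_integral_abs_avg [IsProbabilityMeasure P] {R : ℕ → ℤ → Ω → ℝ} {n : ℕ → ℕ}
    (hn : Tendsto n atTop atTop)
    (hR : ∀ N, ∀ t ∈ Finset.Icc (1 : ℤ) (n N), Integrable (R N t) P)
    (h : ∀ ε : ℝ, 0 < ε → ∃ (m : ℕ) (B : ℝ) (Q : ℕ → ℤ → Ω → ℝ), 0 ≤ B ∧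
      ∀ N, ∀ t ∈ Finset.Icc (1 : ℤ) (n N), Measurable (Q N t) ∧ (∀ ω, |Q N t ω| ≤ B) ∧
        (∀ t' ∈ Finset.Icc (1 : ℤ) (n N), t + m < t' → IndepFun (Q N t) (Q N t') P) ∧
        ∫ ω, |R N t ω - Q N t ω| ∂P ≤ ε) :
    Tendsto (fun N => ∫ ω, |1 / (n N : ℝ) * ∑ t ∈ Finset.Icc (1 : ℤ) (n N),
      (R N t ω - ∫ ω, R N t ω ∂P)| ∂P) atTop (𝓝 0) := by
  refine Metric.tendsto_nhds.2 fun ε hε => ?_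
  -- The replacement costs `ε / 4` for the variable and `ε / 4` for its mean. The fluctuation of the
  -- bounded average is `√K / √n` and takes the other half of `ε`.
  obtain ⟨m, B, Q, hB, hQ⟩ := h (ε / 4) (by positivity)
  set K := (2 * m + 1) * (2 * B) ^ 2 with hK
  have hK0 : 0 ≤ K := by positivity
  have hlim : ∀ᶠ N in atTop, 1 / (n N : ℝ) * √(n N * K) < ε / 2 := by
    have h1 : Tendsto (fun x : ℝ => √K / √x) atTop (𝓝 0) :=
      Real.tendsto_sqrt_atTop.const_div_atTop _
    have h2 := (h1.comp (tendsto_natCast_atTop_atTop.comp hn)).eventually_lt_const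
      (show 0 < ε / 2 by positivity)
    filter_upwards [h2, hn.eventually_gt_atTop 0] with N hN hN0
    have hpos : (0 : ℝ) < n N := by exact_mod_cast hN0
    refine lt_of_eq_of_lt ?_ hN
    simp only [Function.comp]
    rw [Real.sqrt_mul hpos.le]
    have h3 : √(n N : ℝ) ≠ 0 := (Real.sqrt_pos.2 hpos).ne'
    have h4 := Real.mul_self_sqrt hpos.le
    field_simp
    rw [sq, h4]
  filter_upwards [hlim, hn.eventually_gt_atTop 0] with N hN hN0
  have hpos : (0 : ℝ) < n N := by exact_mod_cast hN0
  rw [Real.dist_0_eq_abs, abs_of_nonneg (integral_nonneg fun _ => abs_nonneg _)]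
  have hQi : ∀ t ∈ Finset.Icc (1 : ℤ) (n N), Integrable (Q N t) P := fun t ht =>
    Integrable.of_bound (hQ N t ht).1.aestronglyMeasurable B
      (Eventually.of_forall (hQ N t ht).2.1)
  have hvar := sum_sub_integral_norm (P := P) (Q := Q N) hB (fun t ht => (hQ N t ht).1)
    (fun t ht => (hQ N t ht).2.1) (fun t ht => (hQ N t ht).2.2.1)
  have hvi := hvar.integral_abs_le (Real.sqrt_nonneg _)
  set S : Ω → ℝ := fun ω => ∑ t ∈ Finset.Icc (1 : ℤ) (n N), (Q N t ω - ∫ ω, Q N t ω ∂P) with hS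
  have hSi : Integrable S P := hvar.integrable
  have hd : ∀ t ∈ Finset.Icc (1 : ℤ) (n N),
      |∫ ω, R N t ω ∂P - ∫ ω, Q N t ω ∂P| ≤ ε / 4 := fun t ht => by
    rw [← integral_sub (hR N t ht) (hQi t ht)]
    exact abs_integral_le_integral_abs.trans (hQ N t ht).2.2.2
  have hpt : ∀ ω, |1 / (n N : ℝ) * ∑ t ∈ Finset.Icc (1 : ℤ) (n N), (R N t ω - ∫ ω, R N t ω ∂P)| ≤
      1 / (n N : ℝ) * (∑ t ∈ Finset.Icc (1 : ℤ) (n N), (|R N t ω - Q N t ω| + ε / 4) + |S ω|) := by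
    intro ω
    rw [abs_mul, abs_of_nonneg (by positivity)]
    refine mul_le_mul_of_nonneg_left ?_ (by positivity)
    have h1 : ∑ t ∈ Finset.Icc (1 : ℤ) (n N), (R N t ω - ∫ ω, R N t ω ∂P) =
        ∑ t ∈ Finset.Icc (1 : ℤ) (n N), ((R N t ω - Q N t ω) -
          (∫ ω, R N t ω ∂P - ∫ ω, Q N t ω ∂P)) + S ω := by
      rw [hS, ← Finset.sum_add_distrib]
      exact Finset.sum_congr rfl fun t _ => by ring
    rw [h1]
    refine (abs_add_le _ _).trans (add_le_add_left ?_ _)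
    refine (Finset.abs_sum_le_sum_abs _ _).trans (Finset.sum_le_sum fun t ht => ?_)
    exact (abs_sub _ _).trans (add_le_add_right (hd t ht) _)
  have hi1 : ∀ t ∈ Finset.Icc (1 : ℤ) (n N),
      Integrable (fun ω => |R N t ω - Q N t ω| + ε / 4) P := fun t ht =>
    ((hR N t ht).sub (hQi t ht)).abs.add (integrable_const _)
  calc _ ≤ ∫ ω, 1 / (n N : ℝ) * (∑ t ∈ Finset.Icc (1 : ℤ) (n N),
        (|R N t ω - Q N t ω| + ε / 4) + |S ω|) ∂P := by
        refine integral_mono_of_nonneg (Eventually.of_forall fun _ => abs_nonneg _) ?_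
          (Eventually.of_forall hpt)
        exact ((integrable_finsetSum _ hi1).add hSi.abs).const_mul _
    _ = 1 / (n N : ℝ) * (∑ t ∈ Finset.Icc (1 : ℤ) (n N),
        (∫ ω, |R N t ω - Q N t ω| ∂P + ε / 4) + ∫ ω, |S ω| ∂P) := by
        rw [integral_const_mul, integral_add (integrable_finsetSum _ hi1) hSi.abs,
          integral_finsetSum _ hi1]
        congr 2
        refine Finset.sum_congr rfl fun t ht => ?_
        have hi2 : Integrable (fun ω => |R N t ω - Q N t ω|) P := ((hR N t ht).sub (hQi t ht)).abs
        rw [integral_add hi2 (integrable_const _)]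
        simp
    _ ≤ 1 / (n N : ℝ) * (∑ t ∈ Finset.Icc (1 : ℤ) (n N), (ε / 4 + ε / 4) + √(n N * K)) := by
        refine mul_le_mul_of_nonneg_left (add_le_add (Finset.sum_le_sum fun t ht => ?_) hvi)
          (by positivity)
        exact add_le_add_left (hQ N t ht).2.2.2 _
    _ = ε / 2 + 1 / (n N : ℝ) * √(n N * K) := by
        rw [Finset.sum_const, Int.card_Icc]
        simp only [nsmul_eq_mul, add_sub_cancel_right, Int.toNat_natCast]
        field_simp
        ring
    _ < ε := by linarith

/-! ### Convergence in probability of averages of products -/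

theorem tendstoInMeasure_comp₂ [IsFiniteMeasure P] {f g : ℕ → Ω → ℝ} {c d : ℝ}
    (hf : TendstoInMeasure P f atTop fun _ => c) (hg : TendstoInMeasure P g atTop fun _ => d)
    {F : ℝ → ℝ → ℝ} (hF : ContinuousAt (fun x : ℝ × ℝ => F x.1 x.2) (c, d)) :
    TendstoInMeasure P (fun n ω => F (f n ω) (g n ω)) atTop fun _ => F c d := by
  rw [tendstoInMeasure_iff_measureReal_dist] at *
  intro ε hε
  obtain ⟨δ, hδ, h⟩ := Metric.continuousAt_iff.1 hF ε hε
  refine squeeze_zero (fun _ => measureReal_nonneg) (fun n => ?_)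
    (by simpa using (hf δ hδ).add (hg δ hδ))
  refine (measureReal_mono (s₂ := {ω | δ ≤ dist (f n ω) c} ∪ {ω | δ ≤ dist (g n ω) d})
    fun ω hω => ?_).trans (measureReal_union_le _ _)
  by_contra hcon
  simp only [mem_union, mem_ofPred_eq, not_or, not_le] at hcon hω
  exact absurd (h (x := (f n ω, g n ω)) (by rw [Prod.dist_eq]; exact max_lt hcon.1 hcon.2))
    (not_lt.2 hω)

theorem tendstoInMeasure_of_integral_abs [IsProbabilityMeasure P] {f : ℕ → Ω → ℝ} {g : Ω → ℝ}
    (hi : ∀ᶠ n in atTop, Integrable (fun ω => f n ω - g ω) P)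
    (h : Tendsto (fun n => ∫ ω, |f n ω - g ω| ∂P) atTop (𝓝 0)) :
    TendstoInMeasure P f atTop g :=
  tendstoInMeasure_of_le_mul (M := fun _ _ => 1) (TightFam.const 1) hi
    (Eventually.of_forall fun _ => le_rfl) h
    (Eventually.of_forall fun n => Eventually.of_forall fun ω => by simp)

/-- Replacement of the factors in an average of products, with errors that are small in `L²` up
to a random factor that is bounded in probability. -/
theorem tendstoInMeasure_avg_mul_sub [IsProbabilityMeasure P] {n : ℕ → ℕ}
    {x y x' y' e e' : ℕ → ℤ → Ω → ℝ} {M : ℕ → Ω → ℝ} {ε : ℕ → ℤ → ℝ} {C : ℝ}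
    (hC : 0 ≤ C) (hM : TightFam P M) (hM1 : ∀ N ω, 1 ≤ M N ω)
    (hx' : ∀ᶠ N in atTop, ∀ t ∈ Finset.Icc (1 : ℤ) (n N), NormLe P (x' N t) C)
    (hy' : ∀ᶠ N in atTop, ∀ t ∈ Finset.Icc (1 : ℤ) (n N), NormLe P (y' N t) C)
    (he : ∀ᶠ N in atTop, ∀ t ∈ Finset.Icc (1 : ℤ) (n N), NormLe P (e N t) (ε N t))
    (he' : ∀ᶠ N in atTop, ∀ t ∈ Finset.Icc (1 : ℤ) (n N), NormLe P (e' N t) (ε N t))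
    (hε : ∀ᶠ N in atTop, ∀ t ∈ Finset.Icc (1 : ℤ) (n N), 0 ≤ ε N t ∧ ε N t ≤ C)
    (hlim : Tendsto (fun N => 1 / (n N : ℝ) * ∑ t ∈ Finset.Icc (1 : ℤ) (n N), ε N t) atTop (𝓝 0))
    (hx : ∀ᶠ N in atTop, ∀ t ∈ Finset.Icc (1 : ℤ) (n N), ∀ᵐ ω ∂P,
      |x N t ω - x' N t ω| ≤ M N ω * |e N t ω|)
    (hy : ∀ᶠ N in atTop, ∀ t ∈ Finset.Icc (1 : ℤ) (n N), ∀ᵐ ω ∂P,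
      |y N t ω - y' N t ω| ≤ M N ω * |e' N t ω|) :
    TendstoInMeasure P (fun N ω => 1 / (n N : ℝ) * ∑ t ∈ Finset.Icc (1 : ℤ) (n N),
      (x N t ω * y N t ω - x' N t ω * y' N t ω)) atTop fun _ => 0 := by
  set L : ℕ → Ω → ℝ := fun N ω => 1 / (n N : ℝ) * ∑ t ∈ Finset.Icc (1 : ℤ) (n N),
    (|e N t ω * y' N t ω| + |x' N t ω * e' N t ω| + |e N t ω * e' N t ω|) with hL
  -- By Cauchy–Schwarz each of the three products has mean at most `C ε`. The product of the two
  -- errors has mean at most `ε²`, and `ε ≤ C`.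
  have hLi : ∀ᶠ N in atTop, Integrable (L N) P ∧ ∫ ω, |L N ω| ∂P ≤
      3 * C * (1 / (n N : ℝ) * ∑ t ∈ Finset.Icc (1 : ℤ) (n N), ε N t) := by
    filter_upwards [hx', hy', he, he', hε] with N h1 h2 h3 h4 h5
    have hi1 : ∀ t ∈ Finset.Icc (1 : ℤ) (n N), Integrable (fun ω => |e N t ω * y' N t ω|) P :=
      fun t ht => ((h3 t ht).integrable_mul (h2 t ht)).abs
    have hi2 : ∀ t ∈ Finset.Icc (1 : ℤ) (n N), Integrable (fun ω => |x' N t ω * e' N t ω|) P :=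
      fun t ht => ((h1 t ht).integrable_mul (h4 t ht)).abs
    have hi3 : ∀ t ∈ Finset.Icc (1 : ℤ) (n N), Integrable (fun ω => |e N t ω * e' N t ω|) P :=
      fun t ht => ((h3 t ht).integrable_mul (h4 t ht)).abs
    have hi12 : ∀ t ∈ Finset.Icc (1 : ℤ) (n N),
        Integrable (fun ω => |e N t ω * y' N t ω| + |x' N t ω * e' N t ω|) P :=
      fun t ht => (hi1 t ht).add (hi2 t ht)
    have hi : ∀ t ∈ Finset.Icc (1 : ℤ) (n N), Integrable (fun ω => |e N t ω * y' N t ω| +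
        |x' N t ω * e' N t ω| + |e N t ω * e' N t ω|) P := fun t ht => (hi12 t ht).add (hi3 t ht)
    refine ⟨(integrable_finsetSum _ hi).const_mul _, ?_⟩
    have habs : ∀ ω, |L N ω| = L N ω := fun ω => abs_of_nonneg
      (mul_nonneg (by positivity) (Finset.sum_nonneg fun t _ => by positivity))
    simp only [habs]
    simp only [hL]
    rw [integral_const_mul, integral_finsetSum _ hi, mul_left_comm]
    refine mul_le_mul_of_nonneg_left ?_ (by positivity)
    rw [Finset.mul_sum]
    refine Finset.sum_le_sum fun t ht => ?_
    rw [integral_add (hi12 t ht) (hi3 t ht), integral_add (hi1 t ht) (hi2 t ht)]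
    have h6 := h5 t ht
    have h7 := (h3 t ht).integral_abs_mul_le (h2 t ht) h6.1 hC
    have h8 := (h1 t ht).integral_abs_mul_le (h4 t ht) hC h6.1
    have h9 := (h3 t ht).integral_abs_mul_le ((h4 t ht).mono h6.2) h6.1 hC
    linarith
  -- The product of the two errors carries `M` twice. As `1 ≤ M`, the factor `M ^ 2` also covers the
  -- two terms that carry it once.
  refine tendstoInMeasure_of_le_mul (M := fun N ω => M N ω ^ 2) (L := L) hM.sq
    (hLi.mono fun _ h => h.1) (hLi.mono fun _ h => h.2) (by simpa using hlim.const_mul (3 * C)) ?_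
  filter_upwards [hx, hy] with N h1 h2
  have h1' := (Finset.eventually_all (Finset.Icc (1 : ℤ) (n N))).2 h1
  have h2' := (Finset.eventually_all (Finset.Icc (1 : ℤ) (n N))).2 h2
  filter_upwards [h1', h2'] with ω h3 h4
  rw [sub_zero, abs_mul, abs_of_nonneg (show 0 ≤ 1 / (n N : ℝ) by positivity), ← abs_mul]
  refine le_trans ?_ (le_abs_self _)
  rw [hL]
  simp only
  rw [mul_left_comm]
  refine mul_le_mul_of_nonneg_left ?_ (by positivity)
  rw [Finset.mul_sum]
  refine (Finset.abs_sum_le_sum_abs _ _).trans (Finset.sum_le_sum fun t ht => ?_)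
  have h5 := h3 t ht
  have h6 := h4 t ht
  have hM0 := hM1 N ω
  have hMM : M N ω ≤ M N ω ^ 2 := by nlinarith
  have h7 : x N t ω * y N t ω - x' N t ω * y' N t ω =
      (x N t ω - x' N t ω) * y' N t ω + x' N t ω * (y N t ω - y' N t ω) +
        (x N t ω - x' N t ω) * (y N t ω - y' N t ω) := by ring
  rw [h7, mul_add, mul_add]
  refine (abs_add_three _ _ _).trans (add_le_add_three ?_ ?_ ?_)
  · rw [abs_mul, abs_mul]
    calc _ ≤ M N ω * |e N t ω| * |y' N t ω| := by gcongr
      _ ≤ M N ω ^ 2 * |e N t ω| * |y' N t ω| := by gcongr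
      _ = _ := by ring
  · rw [abs_mul, abs_mul]
    calc _ ≤ |x' N t ω| * (M N ω * |e' N t ω|) := by gcongr
      _ ≤ |x' N t ω| * (M N ω ^ 2 * |e' N t ω|) := by gcongr
      _ = _ := by ring
  · rw [abs_mul, abs_mul]
    calc _ ≤ (M N ω * |e N t ω|) * (M N ω * |e' N t ω|) := by gcongr
      _ = _ := by ring

/-! ### Hölder functions, Riemann sums and Cesàro means -/

theorem sum_Icc_int (n : ℕ) (f : ℤ → ℝ) :
    ∑ t ∈ Finset.Icc (1 : ℤ) n, f t = ∑ i ∈ Finset.range n, f (i + 1) := by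
  symm
  refine Finset.sum_bij' (fun i _ => (i : ℤ) + 1) (fun t _ => (t - 1).toNat) ?_ ?_ ?_ ?_ ?_
  · intro i hi; simp at hi ⊢; omega
  · intro t ht; simp at ht ⊢; omega
  · intro i hi; simp
  · intro t ht; simp at ht ⊢; omega
  · intro i hi; rfl

/-- `f` is Hölder continuous on `(0, 1]`. -/
def HolderIoc (f : ℝ → ℝ) : Prop :=
  ∃ β K : ℝ, 0 < β ∧ 0 ≤ K ∧
    ∀ u ∈ Ioc (0 : ℝ) 1, ∀ v ∈ Ioc (0 : ℝ) 1, |f u - f v| ≤ K * |u - v| ^ β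

namespace HolderIoc

variable {f : ℝ → ℝ}

theorem continuousOn (hf : HolderIoc f) : ContinuousOn f (Ioc 0 1) := by
  obtain ⟨β, K, hβ, hK, h⟩ := hf
  intro u hu
  rw [ContinuousWithinAt, tendsto_iff_dist_tendsto_zero]
  have h1 : Tendsto (fun v : ℝ => K * |v - u| ^ β) (𝓝[Ioc 0 1] u) (𝓝 0) := by
    have h2 : Continuous fun v : ℝ => K * |v - u| ^ β :=
      continuous_const.mul ((by fun_prop : Continuous fun v : ℝ => |v - u|).rpow_const
        fun _ => Or.inr hβ.le)
    have h3 := (h2.tendsto u).mono_left (nhdsWithin_le_nhds (s := Ioc 0 1))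
    simpa [Real.zero_rpow hβ.ne'] using h3
  exact squeeze_zero' (Eventually.of_forall fun _ => dist_nonneg)
    (eventually_nhdsWithin_of_forall fun v hv => h v hv u hu) h1

theorem bounded (hf : HolderIoc f) : ∃ C, 0 ≤ C ∧ ∀ u ∈ Ioc (0 : ℝ) 1, |f u| ≤ C := by
  obtain ⟨β, K, hβ, hK, h⟩ := hf
  refine ⟨|f 1| + K, by positivity, fun u hu => ?_⟩
  have h1 := h u hu 1 (by simp)
  have h2 : |u - 1| ^ β ≤ 1 := Real.rpow_le_one (abs_nonneg _)
    (abs_le.2 ⟨by linarith [hu.1], by linarith [hu.2]⟩) hβ.le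
  have h3 : |f u| ≤ |f u - f 1| + |f 1| := by
    simpa using abs_add_le (f u - f 1) (f 1)
  nlinarith

theorem integrableOn (hf : HolderIoc f) : IntegrableOn f (Ioc 0 1) := by
  obtain ⟨C, -, hC⟩ := hf.bounded
  refine IntegrableOn.of_bound (by simp)
    (hf.continuousOn.aestronglyMeasurable measurableSet_Ioc) C ?_
  exact (ae_restrict_iff' measurableSet_Ioc).2 (Eventually.of_forall fun u hu => by
    simpa using hC u hu)

theorem integrableOn_sq (hf : HolderIoc f) : IntegrableOn (fun u => f u ^ 2) (Ioc 0 1) := by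
  obtain ⟨C, hC0, hC⟩ := hf.bounded
  refine IntegrableOn.of_bound (by simp)
    ((hf.continuousOn.pow 2).aestronglyMeasurable measurableSet_Ioc) (C ^ 2) ?_
  refine (ae_restrict_iff' measurableSet_Ioc).2 (Eventually.of_forall fun u hu => ?_)
  rw [norm_pow, Real.norm_eq_abs]
  gcongr
  exact hC u hu

theorem intervalIntegrable (hf : HolderIoc f) : IntervalIntegrable f volume 0 1 :=
  (intervalIntegrable_iff_integrableOn_Ioc_of_le zero_le_one).2 hf.integrableOn

/-- Convergence of Riemann sums. -/
theorem tendsto_riemann (hf : HolderIoc f) (h : ℕ) :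
    Tendsto (fun N : ℕ => 1 / ((N - h : ℕ) : ℝ) *
      ∑ t ∈ Finset.Icc (1 : ℤ) (N - h : ℕ), f ((t : ℝ) / (N : ℝ))) atTop
      (𝓝 (∫ u in (0 : ℝ)..1, f u)) := by
  have hint := hf.intervalIntegrable
  obtain ⟨β, K, hβ, hK, hH⟩ := hf
  have hn : Tendsto (fun N : ℕ => ((N - h : ℕ) : ℝ)) atTop atTop :=
    tendsto_natCast_atTop_atTop.comp (tendsto_sub_atTop_nat h)
  have hlim : Tendsto (fun N : ℕ => K * ((h + 1 : ℝ) / ((N - h : ℕ) : ℝ)) ^ β) atTop (𝓝 0) := by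
    have h1 : Tendsto (fun N : ℕ => (h + 1 : ℝ) / ((N - h : ℕ) : ℝ)) atTop (𝓝 0) :=
      hn.const_div_atTop _
    have h2 := (h1.rpow_const (p := β) (Or.inr hβ.le)).const_mul K
    simpa [Real.zero_rpow hβ.ne'] using h2
  rw [tendsto_iff_dist_tendsto_zero]
  refine squeeze_zero' (Eventually.of_forall fun _ => dist_nonneg) ?_ hlim
  filter_upwards [eventually_gt_atTop h] with N hN
  obtain ⟨n, rfl⟩ := Nat.exists_eq_add_of_lt hN
  have hnN : h + n + 1 - h = n + 1 := by omega
  rw [hnN, sum_Icc_int]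
  set m : ℕ := n + 1 with hm
  have hm0 : (0 : ℝ) < m := by positivity
  have hNm : ((h + n + 1 : ℕ) : ℝ) = h + m := by push_cast [hm]; ring
  rw [hNm]
  have hII : ∀ i < m, IntervalIntegrable f volume ((i : ℝ) / m) (((i + 1 : ℕ) : ℝ) / m) := by
    intro i hi
    refine hint.mono_set ?_
    have h1 : ((i + 1 : ℕ) : ℝ) ≤ m := by exact_mod_cast hi
    rw [uIcc_of_le (by gcongr; simp), uIcc_of_le zero_le_one]
    exact Icc_subset_Icc (by positivity) ((div_le_one hm0).2 h1)
  have hsum := intervalIntegral.sum_integral_adjacent_intervals (f := f) (μ := volume)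
    (a := fun i : ℕ => (i : ℝ) / m) (n := m) hII
  simp only [Nat.cast_zero, zero_div, div_self hm0.ne'] at hsum
  rw [← hsum, Finset.mul_sum, Real.dist_eq, ← Finset.sum_sub_distrib]
  -- With `m = N - h` cells of length `1 / m`, the node `(i + 1) / N` lies up to `h / m` to the left
  -- of the right end of its cell, possibly outside the cell. Its distance to every point of the
  -- cell is thus at most `(h + 1) / m`.
  have hterm : ∀ i ∈ Finset.range m,
      |1 / (m : ℝ) * f ((((i : ℤ) + 1 : ℤ) : ℝ) / (h + m)) -
        ∫ u in ((i : ℝ) / m)..(((i + 1 : ℕ) : ℝ) / m), f u| ≤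
      K * ((h + 1 : ℝ) / m) ^ β * (1 / m) := by
    intro i hi
    have hi' : i < m := Finset.mem_range.1 hi
    have hi1 : ((i + 1 : ℕ) : ℝ) ≤ m := by exact_mod_cast hi'
    push_cast at hi1 ⊢
    set v : ℝ := ((i : ℝ) + 1) / (h + m) with hv
    have hhm : (0 : ℝ) < h + m := by positivity
    have hvI : v ∈ Ioc (0 : ℝ) 1 :=
      ⟨by positivity, (div_le_one hhm).2 (by linarith [Nat.cast_nonneg (α := ℝ) h])⟩
    have hlen : ((i : ℝ) + 1) / m - (i : ℝ) / m = 1 / m := by ring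
    have h1 : ∫ u in ((i : ℝ) / m)..(((i : ℝ) + 1) / m), (f v - f u) =
        1 / (m : ℝ) * f v - ∫ u in ((i : ℝ) / m)..(((i : ℝ) + 1) / m), f u := by
      rw [intervalIntegral.integral_sub (by simp) (by simpa using hII i hi'),
        intervalIntegral.integral_const, hlen, smul_eq_mul]
    rw [← h1]
    have h2 := intervalIntegral.norm_integral_le_of_norm_le_const (a := (i : ℝ) / m)
      (b := ((i : ℝ) + 1) / m) (f := fun u => f v - f u) (C := K * ((h + 1 : ℝ) / m) ^ β) ?_
    · rwa [hlen, abs_of_pos (show (0 : ℝ) < 1 / m by positivity)] at h2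
    · intro u hu
      rw [uIoc_of_le (by gcongr; simp)] at hu
      have huI : u ∈ Ioc (0 : ℝ) 1 :=
        ⟨lt_of_le_of_lt (by positivity) hu.1, hu.2.trans ((div_le_one hm0).2 hi1)⟩
      refine (hH v hvI u huI).trans ?_
      gcongr
      have h3 : v ≤ ((i : ℝ) + 1) / m := by
        rw [hv]; gcongr; linarith [Nat.cast_nonneg (α := ℝ) h]
      have h4 : ((i : ℝ) + 1) / m - v ≤ h / m := by
        rw [hv, div_sub_div _ _ hm0.ne' hhm.ne', div_le_div_iff₀ (by positivity) hm0]
        have : (0 : ℝ) ≤ h * m := by positivity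
        nlinarith [mul_le_mul_of_nonneg_left hi1 this, mul_nonneg this (Nat.cast_nonneg (α := ℝ) h),
          mul_nonneg this hm0.le]
      have h5 : (h + 1 : ℝ) / m = h / m + 1 / m := by ring
      have h6 : (0 : ℝ) ≤ h / m := by positivity
      have h7 : (0 : ℝ) < 1 / m := by positivity
      rw [abs_le, h5]
      constructor <;> linarith [hu.1, hu.2]
  refine (Finset.abs_sum_le_sum_abs _ _).trans ((Finset.sum_le_sum hterm).trans_eq ?_)
  rw [Finset.sum_const, Finset.card_range, nsmul_eq_mul]
  field_simp

end HolderIoc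

/-- The influence of the initial values is summable in `t`, so averaging removes it although it is
not small for small `t`. -/
theorem tendsto_avg_of_geometric {r c : ℝ} (hr0 : 0 ≤ r) (hr : r < 1) (hc : 0 ≤ c) {δ : ℕ → ℝ}
    (hδ : Tendsto δ atTop (𝓝 0)) (hδ0 : ∀ N, 0 ≤ δ N) {n : ℕ → ℕ}
    (hn : Tendsto n atTop atTop) :
    Tendsto (fun N => 1 / (n N : ℝ) * ∑ t ∈ Finset.Icc (1 : ℤ) (n N), (c * r ^ t + δ N)) atTop
      (𝓝 0) := by
  have h1 : Tendsto (fun N => c / (1 - r) / (n N : ℝ) + δ N) atTop (𝓝 0) := by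
    simpa using ((tendsto_natCast_atTop_atTop.comp hn).const_div_atTop (c / (1 - r))).add hδ
  refine squeeze_zero' (Eventually.of_forall fun N => ?_) ?_ h1
  · refine mul_nonneg (by positivity) (Finset.sum_nonneg fun t _ => ?_)
    have := hδ0 N
    positivity
  · filter_upwards [hn.eventually_gt_atTop 0] with N hN
    have hN' : (0 : ℝ) < n N := by exact_mod_cast hN
    rw [sum_Icc_int, Finset.sum_add_distrib, Finset.sum_const, Finset.card_range, nsmul_eq_mul,
      ← Finset.mul_sum]
    have h2 : ∑ i ∈ Finset.range (n N), r ^ ((i : ℤ) + 1) ≤ 1 / (1 - r) := by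
      have h3 := Summable.sum_le_tsum (Finset.range (n N)) (fun i _ => pow_nonneg hr0 i)
        (summable_geometric_of_lt_one hr0 hr)
      rw [tsum_geometric_of_lt_one hr0 hr, ← one_div] at h3
      refine (Finset.sum_le_sum fun i _ => ?_).trans h3
      have : r ^ ((i : ℤ) + 1) = r ^ (i + 1) := by exact_mod_cast zpow_natCast r (i + 1)
      rw [this]
      exact pow_le_pow_of_le_one hr0 hr.le (Nat.le_succ i)
    calc 1 / (n N : ℝ) * (c * ∑ i ∈ Finset.range (n N), r ^ ((i : ℤ) + 1) + n N * δ N)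
        ≤ 1 / (n N : ℝ) * (c * (1 / (1 - r)) + n N * δ N) := by gcongr
      _ = _ := by field_simp

/-! ### The integral over the triangle -/

section triangle

variable {f : ℝ → ℝ}

/-- The edge `u = 0` belongs to the triangle, but the parameters are controlled only on `(0, 1]`; it
is a null set. -/
theorem triangle_ae_eq :
    triangle =ᵐ[volume] ({q | q.1 < q.2} ∩ Ioc (0 : ℝ) 1 ×ˢ Ioc (0 : ℝ) 1 : Set (ℝ × ℝ)) := by
  have h : ∀ᵐ q : ℝ × ℝ, q.1 ≠ 0 := by
    have h1 : {q : ℝ × ℝ | ¬ q.1 ≠ 0} = ({0} : Set ℝ) ×ˢ univ := by ext; simp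
    rw [ae_iff, h1, Measure.volume_eq_prod, Measure.prod_prod]
    simp
  filter_upwards [h] with q hq
  refine propext ⟨fun ⟨h1, h2, h3⟩ => ?_, fun ⟨h1, h2⟩ => ?_⟩
  · have h4 := lt_of_le_of_ne h1 (Ne.symm hq)
    exact ⟨h2, ⟨h4, h2.le.trans h3⟩, ⟨h4.trans h2, h3⟩⟩
  · exact ⟨h2.1.1.le, h1, h2.2.2⟩

theorem integrableOn_sq_sub (hf : HolderIoc f) :
    IntegrableOn (fun q : ℝ × ℝ => (f q.1 - f q.2) ^ 2) (Ioc (0 : ℝ) 1 ×ˢ Ioc (0 : ℝ) 1) := by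
  obtain ⟨C, hC0, hC⟩ := hf.bounded
  have hm : MeasurableSet (Ioc (0 : ℝ) 1 ×ˢ Ioc (0 : ℝ) 1) :=
    measurableSet_Ioc.prod measurableSet_Ioc
  refine IntegrableOn.of_bound ?_ (ContinuousOn.aestronglyMeasurable ?_ hm) ((2 * C) ^ 2) ?_
  · rw [Measure.volume_eq_prod, Measure.prod_prod]; simp
  · exact ((hf.continuousOn.comp continuousOn_fst fun q hq => hq.1).sub
      (hf.continuousOn.comp continuousOn_snd fun q hq => hq.2)).pow 2
  · refine (ae_restrict_iff' hm).2 (Eventually.of_forall fun q hq => ?_)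
    rw [norm_pow, Real.norm_eq_abs]
    gcongr
    exact (abs_sub _ _).trans (by linarith [hC _ hq.1, hC _ hq.2])

theorem integrableOn_triangle (hf : HolderIoc f) :
    IntegrableOn (fun q : ℝ × ℝ => (f q.1 - f q.2) ^ 2) triangle :=
  ((integrableOn_sq_sub hf).mono_set inter_subset_right).congr_set_ae triangle_ae_eq

/-- Both sides are the variance of `f(U)` for `U` uniform, which equals half of `E (f(U) - f(V))²`
for an independent copy `V`. By symmetry the triangle carries half of the integral over the square,
the integrand being zero on the diagonal. -/
theorem setIntegral_triangle (hf : HolderIoc f) :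
    ∫ q in triangle, (f q.1 - f q.2) ^ 2 =
      (∫ u in (0 : ℝ)..1, f u ^ 2) - (∫ u in (0 : ℝ)..1, f u) ^ 2 := by
  set I : Set (ℝ × ℝ) := Ioc (0 : ℝ) 1 ×ˢ Ioc (0 : ℝ) 1 with hI
  set F : ℝ × ℝ → ℝ := fun q => (f q.1 - f q.2) ^ 2 with hF
  have hIm : MeasurableSet I := measurableSet_Ioc.prod measurableSet_Ioc
  have hlt : MeasurableSet {q : ℝ × ℝ | q.1 < q.2} := measurableSet_lt measurable_fst measurable_snd
  have hgt : MeasurableSet {q : ℝ × ℝ | q.2 < q.1} := measurableSet_lt measurable_snd measurable_fst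
  have hFi : IntegrableOn F I := integrableOn_sq_sub hf
  rw [setIntegral_congr_set triangle_ae_eq]
  change ∫ q in {q : ℝ × ℝ | q.1 < q.2} ∩ I, F q = _
  have hsplit : ∫ q in I, F q = (∫ q in {q : ℝ × ℝ | q.1 < q.2} ∩ I, F q) +
      ∫ q in {q : ℝ × ℝ | q.2 < q.1} ∩ I, F q := by
    have hdisj : Disjoint ({q : ℝ × ℝ | q.1 < q.2} ∩ I) ({q : ℝ × ℝ | q.2 < q.1} ∩ I) := by
      refine Set.disjoint_left.2 fun q h1 h2 => ?_
      have h3 : q.1 < q.2 := h1.1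
      exact lt_asymm h3 h2.1
    rw [← setIntegral_union hdisj
      (hgt.inter hIm) (hFi.mono_set inter_subset_right) (hFi.mono_set inter_subset_right)]
    refine setIntegral_eq_of_subset_of_forall_sdiff_eq_zero hIm
      (union_subset inter_subset_right inter_subset_right) fun q hq => ?_
    have h1 : q.1 = q.2 := by
      by_contra hne
      rcases lt_or_gt_of_ne hne with h | h
      · exact hq.2 (Or.inl ⟨h, hq.1⟩)
      · exact hq.2 (Or.inr ⟨h, hq.1⟩)
    simp [hF, h1]
  have hswap : ∫ q in {q : ℝ × ℝ | q.2 < q.1} ∩ I, F q =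
      ∫ q in {q : ℝ × ℝ | q.1 < q.2} ∩ I, F q := by
    have h1 := (Measure.measurePreserving_swap (μ := (volume : Measure ℝ))
      (ν := (volume : Measure ℝ))).setIntegral_preimage_emb
      MeasurableEquiv.prodComm.measurableEmbedding F ({q : ℝ × ℝ | q.1 < q.2} ∩ I)
    rw [← Measure.volume_eq_prod] at h1
    rw [← h1]
    have h2 : Prod.swap ⁻¹' ({q : ℝ × ℝ | q.1 < q.2} ∩ I) = {q : ℝ × ℝ | q.2 < q.1} ∩ I := by
      ext q; simp [hI]
    rw [h2]
    refine setIntegral_congr_fun (hgt.inter hIm) fun q _ => ?_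
    simp only [hF, Prod.fst_swap, Prod.snd_swap]
    ring
  have hfi := hf.integrableOn
  have hf2 := hf.integrableOn_sq
  have h1i : IntegrableOn (fun _ : ℝ => (1 : ℝ)) (Ioc (0 : ℝ) 1) := by simp
  have hprod : ∀ g g' : ℝ → ℝ, IntegrableOn g (Ioc 0 1) → IntegrableOn g' (Ioc 0 1) →
      IntegrableOn (fun q : ℝ × ℝ => g q.1 * g' q.2) I := by
    intro g g' hg hg'
    have := hg.mul_prod hg'
    rwa [Measure.prod_restrict, ← Measure.volume_eq_prod] at this
  have hexp : ∫ q in I, F q = 2 * (∫ u in Ioc (0 : ℝ) 1, f u ^ 2) -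
      2 * (∫ u in Ioc (0 : ℝ) 1, f u) ^ 2 := by
    have h2 : ∫ q in I, F q = ∫ q in I, ((f q.1 ^ 2 * 1 + 1 * f q.2 ^ 2) - 2 * (f q.1 * f q.2)) :=
      setIntegral_congr_fun hIm fun q _ => by simp only [hF]; ring
    have h3 : Integrable (fun q : ℝ × ℝ => f q.1 ^ 2 * 1 + 1 * f q.2 ^ 2) (volume.restrict I) :=
      (hprod _ _ hf2 h1i).add (hprod _ _ h1i hf2)
    rw [h2, integral_sub h3
      ((hprod _ _ hfi hfi).const_mul 2), integral_add (hprod _ _ hf2 h1i) (hprod _ _ h1i hf2),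
      integral_const_mul (2 : ℝ), Measure.volume_eq_prod, hI,
      setIntegral_prod_mul (fun u => f u ^ 2) (fun _ => (1 : ℝ)),
      setIntegral_prod_mul (fun _ => (1 : ℝ)) (fun u => f u ^ 2),
      setIntegral_prod_mul f f]
    simp
    ring
  rw [intervalIntegral.integral_of_le zero_le_one, intervalIntegral.integral_of_le zero_le_one]
  rw [hswap] at hsplit
  linarith

theorem setIntegral_triangle_pos (hf : HolderIoc f)
    (hne : ∃ u ∈ Ioc (0 : ℝ) 1, ∃ v ∈ Ioc (0 : ℝ) 1, f u ≠ f v) :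
    0 < ∫ q in triangle, (f q.1 - f q.2) ^ 2 := by
  have hne' : ∃ u ∈ Ioc (0 : ℝ) 1, ∃ v ∈ Ioc (0 : ℝ) 1, u < v ∧ f u ≠ f v := by
    obtain ⟨u, hu, v, hv, h⟩ := hne
    rcases lt_trichotomy u v with h1 | h1 | h1
    · exact ⟨u, hu, v, hv, h1, h⟩
    · exact absurd (congrArg f h1) h
    · exact ⟨v, hv, u, hu, h1, h.symm⟩
  obtain ⟨u, hu, v, hv, huv, h⟩ := hne'
  rw [setIntegral_pos_iff_support_of_nonneg_ae (Eventually.of_forall fun _ => sq_nonneg _)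
    (integrableOn_triangle hf)]
  have hd : 0 < |f u - f v| := abs_pos.2 (sub_ne_zero.2 h)
  obtain ⟨η₁, hη₁, h1⟩ := Metric.continuousWithinAt_iff.1 (hf.continuousOn u hu) _ (half_pos hd)
  obtain ⟨η₂, hη₂, h2⟩ := Metric.continuousWithinAt_iff.1 (hf.continuousOn v hv) _ (half_pos hd)
  -- Intervals to the left of `u` and of `v` remain in `(0, 1]` even if `v = 1`. The bound `η ≤ u`
  -- keeps them positive, and `η ≤ v - u` puts the box inside the triangle.
  set η := min (min η₁ η₂) (min u (v - u)) with hη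
  have hη0 : 0 < η := lt_min (lt_min hη₁ hη₂) (lt_min hu.1 (by linarith))
  have e1 : η ≤ η₁ := (min_le_left _ _).trans (min_le_left _ _)
  have e2 : η ≤ η₂ := (min_le_left _ _).trans (min_le_right _ _)
  have e3 : η ≤ u := (min_le_right _ _).trans (min_le_left _ _)
  have e4 : η ≤ v - u := (min_le_right _ _).trans (min_le_right _ _)
  refine lt_of_lt_of_le (b := volume (Ioo (u - η) u ×ˢ Ioo (v - η) v)) ?_ (measure_mono ?_)
  · rw [Measure.volume_eq_prod, Measure.prod_prod]
    simp [hη0]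
  · rintro ⟨x, y⟩ ⟨hx, hy⟩
    simp only [mem_Ioo] at hx hy
    have hxI : x ∈ Ioc (0 : ℝ) 1 := ⟨by linarith, by linarith [hu.2]⟩
    have hyI : y ∈ Ioc (0 : ℝ) 1 := ⟨by linarith, by linarith [hv.2]⟩
    refine ⟨?_, hxI.1.le, by simp only; linarith, hyI.2⟩
    have h3 := h1 hxI (by rw [Real.dist_eq, abs_lt]; constructor <;> linarith)
    have h4 := h2 hyI (by rw [Real.dist_eq, abs_lt]; constructor <;> linarith)
    rw [Real.dist_eq] at h3 h4
    rw [Function.mem_support]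
    refine pow_ne_zero 2 fun h0 => ?_
    simp only at h0
    have h5 : |f u - f v| ≤ |f x - f u| + |f y - f v| := by
      have : f u - f v = -(f x - f u) + (f y - f v) := by linarith
      rw [this, ← abs_neg (f x - f u)]
      exact abs_add_le _ _
    linarith

end triangle

/-- For a stationary process all times share one law, so this gives boundedness in probability of
the whole path without any moment assumption. -/
theorem tightFam_singleton [IsFiniteMeasure P] {f : Ω → ℝ} (hf : Measurable f) :
    TightFam P fun _ : Unit => f := by
  intro ε hε
  have h1 : Tendsto (fun n : ℕ => P {ω | (n : ℝ) < |f ω|}) atTop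
      (𝓝 (P (⋂ n : ℕ, {ω | (n : ℝ) < |f ω|}))) :=
    tendsto_measure_iInter_atTop
      (fun n => (measurableSet_lt measurable_const (by fun_prop)).nullMeasurableSet)
      (fun m n hmn ω (hω : (n : ℝ) < |f ω|) => lt_of_le_of_lt (Nat.cast_le.2 hmn) hω) ⟨0, measure_ne_top _ _⟩
  have h2 : ⋂ n : ℕ, {ω | (n : ℝ) < |f ω|} = ∅ := by
    refine eq_empty_of_forall_notMem fun ω hω => ?_
    obtain ⟨n, hn⟩ := exists_nat_ge |f ω|
    exact absurd (mem_iInter.1 hω n) (not_lt.2 hn)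
  rw [h2, measure_empty] at h1
  obtain ⟨n, hn⟩ := (h1.eventually_le_const (ENNReal.ofReal_pos.2 hε)).exists
  exact ⟨n, fun _ => ENNReal.toReal_le_of_le_ofReal hε.le hn⟩

/-! ### Comparison and bounded approximation of causal solutions -/

section causal

variable {p : ℕ} {b b' : ℕ → ℤ → ℝ} {κ R q : ℝ} {z : ℤ → Ω → ℝ} {φ : ℝ → ℝ}

/-- Comparison of two causal solutions whose coefficients are close to each other on a window. -/
theorem archLim_sub_norm_of_window [IsProbabilityMeasure P] (hI : Innov P z φ κ)
    (hb : Coef p κ R q b) (hb' : Coef p κ R q b') (hq0 : 0 ≤ q) (hq : q < 1) {η : ℝ} (hη : 0 ≤ η)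
    (k : ℕ) (t : ℤ) (h : ∀ s, t - k * p ≤ s → s ≤ t → ∀ j ≤ p, |b j s - b' j s| ≤ η) :
    NormLe P (fun ω => archLim p b (fun s ω => φ (z s ω)) t ω -
      archLim p b' (fun s ω => φ (z s ω)) t ω)
      (2 * (κ * R / (1 - q) ^ 2) * q ^ k + κ * (1 + p * (κ * R / (1 - q))) / (1 - q) * η) := by
  have hR := hb.R_nonneg
  have hκ := hI.pos
  have hq' : 0 < 1 - q := by linarith
  have h1 := archLim_sub_norm hI hb hq0 hq k t
  have h2 := archLim_sub_norm hI hb' hq0 hq k t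
  have h3 := arch_perturb hI hI (τ := 0) (fun t => by simpa using NormLe.zero) le_rfl hb hb' hq
    hη k t h
  refine (((h1.sub h2 (by positivity) (by positivity)).add h3 (by positivity)
    (by positivity)).mono (le_of_eq ?_)).congr (Eventually.of_forall fun ω => ?_)
  · ring
  · ring

/-- Approximation of the causal solution by bounded functions of finitely many innovations,
uniformly in the coefficients. -/
theorem exists_bounded_approx [IsProbabilityMeasure P] (hI : Innov P z φ κ)
    (hid : ∀ t, IdentDistrib (z t) (z 0) P P) (hR : 0 ≤ R) (hq0 : 0 ≤ q)
    (hq : q < 1) {ε : ℝ} (hε : 0 < ε) :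
    ∃ (k : ℕ) (D : ℝ) (ψ : ℝ → ℝ), 0 ≤ D ∧ Measurable ψ ∧ ∀ b, Coef p κ R q b → ∀ t,
      (∀ ω, |arch p b (fun s ω => ψ (z s ω)) k t ω| ≤ D) ∧
      NormLe P (arch p b (fun s ω => ψ (z s ω)) k t) (κ * R / (1 - q)) ∧
      NormLe P (fun ω => archLim p b (fun s ω => φ (z s ω)) t ω -
        arch p b (fun s ω => ψ (z s ω)) k t ω) ε := by
  have hκ := hI.pos
  have hq' : 0 < 1 - q := by linarith
  obtain ⟨k, hk⟩ : ∃ k : ℕ, κ * R / (1 - q) ^ 2 * q ^ k ≤ ε / 2 := by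
    have h1 := (tendsto_pow_atTop_nhds_zero_of_lt_one hq0 hq).const_mul (κ * R / (1 - q) ^ 2)
    rw [mul_zero] at h1
    exact (h1.eventually_le_const (half_pos hε)).exists
  -- `G` is the factor of `τ` in `arch_perturb` when the coefficients agree, so truncation with `τ =
  -- ε / 2 / (G + 1)` costs at most `ε / 2`. Stopping the iteration at `k` costs the other half. One
  -- level `B` serves all times, as the innovations are identically distributed.
  set G : ℝ := (R + κ * R / (1 - q)) / (1 - q) with hG
  have hG0 : 0 ≤ G := by positivity
  have hτ : 0 < ε / 2 / (G + 1) := by positivity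
  obtain ⟨B, hB0, hB⟩ := exists_truncation (P := P) (f := fun ω => φ (z 0 ω))
    (hI.norm 0).memLp (hI.measurable_innov 0) (fun ω => hI.nonneg _) hτ
  obtain ⟨D, hD0, hD⟩ := arch_bounded (Ω := Ω) p R κ q hB0 k
  have hψ : Measurable fun x => min (φ x) B := hI.measurable_fun.min measurable_const
  have hI' : Innov P z (fun x => min (φ x) B) κ :=
    { measurable := hI.measurable
      indep := hI.indep
      measurable_fun := hψ
      nonneg := fun x => le_min (hI.nonneg x) hB0
      pos := hκ
      norm := fun t => (hI.norm t).of_abs_le (hψ.comp (hI.measurable t)).aestronglyMeasurable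
        (Eventually.of_forall fun ω => by
          rw [abs_of_nonneg (le_min (hI.nonneg _) hB0), abs_of_nonneg (hI.nonneg _)]
          exact min_le_left _ _) }
  have hB' : ∀ t, NormLe P (fun ω => φ (z t ω) - min (φ (z t ω)) B) (ε / 2 / (G + 1)) := by
    intro t
    refine ⟨((hI.measurable_innov t).sub (hψ.comp (hI.measurable t))).aestronglyMeasurable, ?_⟩
    have := ((hid t).comp (u := fun x => φ x - min (φ x) B)
      (hI.measurable_fun.sub hψ)).eLpNorm_eq 2
    exact this.trans_le hB.2
  refine ⟨k, D, _, hD0, hψ, fun b hb t => ⟨fun ω => hD b hb _ (fun t ω => hI'.nonneg _)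
    (fun t ω => min_le_right _ _) t ω, arch_norm hI' hb hq k t, ?_⟩⟩
  have h3 := arch_perturb hI hI' hB' hτ.le hb hb hq le_rfl k t (fun s _ _ j _ => by simp)
  refine (((archLim_sub_norm hI hb hq0 hq k t).add h3 (by positivity) (by positivity)).mono
    ?_).congr (Eventually.of_forall fun ω => ?_)
  · have h4 : (ε / 2 / (G + 1) * (R + κ * R / (1 - q)) +
        κ * (0 * (1 + p * (κ * R / (1 - q))))) / (1 - q) = ε / 2 * (G / (G + 1)) := by
      rw [hG]; field_simp; ring
    have h5 : G / (G + 1) ≤ 1 := (div_le_one (by positivity)).2 (by linarith)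
    rw [h4]
    nlinarith
  · ring

end causal

/-! ### The stationary processes with frozen parameters -/

/-- Parameter functions and innovations satisfying an `L²` contraction, with all constants. -/
structure Admissible (P : Measure Ω) (p : ℕ) (a : ℕ → ℝ → ℝ) (Z : ℤ → Ω → ℝ)
    (κ R q r β K : ℝ) : Prop where
  innov : Innov P Z (fun x => x ^ 2) κ
  identDistrib : ∀ t, IdentDistrib (Z t) (Z 0) P P
  coef : ∀ U : ℤ → ℝ, (∀ t, U t ∈ Ioc (0 : ℝ) 1) → Coef p κ R q fun j t => a j (U t)
  holder : ∀ j ≤ p, ∀ u ∈ Ioc (0 : ℝ) 1, ∀ v ∈ Ioc (0 : ℝ) 1, |a j u - a j v| ≤ K * |u - v| ^ β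
  R_nonneg : 0 ≤ R
  q_pos : 0 < q
  q_lt : q < 1
  r_pos : 0 < r
  r_lt : r < 1
  r_pow : r ^ (p + 1) = q
  β_pos : 0 < β
  K_nonneg : 0 ≤ K

/-- The squares of the stationary process with parameters frozen at `u`. -/
def localSq (p : ℕ) (a : ℕ → ℝ → ℝ) (Z : ℤ → Ω → ℝ) (u : ℝ) : ℤ → Ω → ℝ :=
  archLim p (fun j _ => a j u) fun s ω => Z s ω ^ 2

namespace Admissible

variable {p : ℕ} {a : ℕ → ℝ → ℝ} {Z : ℤ → Ω → ℝ} {κ R q r β K : ℝ}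

/-- The root of order `p + 1`, instead of `p`, makes sense for `p = 0` and leaves room for disjoint
windows in `abs_integral_mul_sub_le`. -/
theorem q_le_r_pow (hA : Admissible P p a Z κ R q r β K) : q ≤ r ^ p := by
  rw [← hA.r_pow]
  exact pow_le_pow_of_le_one hA.r_pos.le hA.r_lt.le (Nat.le_succ p)

theorem κ_nonneg (hA : Admissible P p a Z κ R q r β K) : 0 ≤ κ := hA.innov.pos

theorem one_sub_q_pos (hA : Admissible P p a Z κ R q r β K) : 0 < 1 - q := by
  linarith [hA.q_lt]

theorem coef_const (hA : Admissible P p a Z κ R q r β K) {u : ℝ} (hu : u ∈ Ioc (0 : ℝ) 1) :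
    Coef p κ R q fun j _ => a j u := hA.coef (fun _ => u) fun _ => hu

theorem bound_nonneg (hA : Admissible P p a Z κ R q r β K) : 0 ≤ κ * R / (1 - q) :=
  div_nonneg (mul_nonneg hA.κ_nonneg hA.R_nonneg) hA.one_sub_q_pos.le

variable [IsProbabilityMeasure P]

theorem localSq_norm (hA : Admissible P p a Z κ R q r β K) {u : ℝ} (hu : u ∈ Ioc (0 : ℝ) 1)
    (t : ℤ) : NormLe P (localSq p a Z u t) (κ * R / (1 - q)) :=
  archLim_norm hA.innov (hA.coef_const hu) hA.q_pos.le hA.q_lt t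

/-- Squares of a stationary ARCH process agree with those of the causal one. -/
theorem sq_ae_eq_localSq (hA : Admissible P p a Z κ R q r β K) {u : ℝ} (hu : u ∈ Ioc (0 : ℝ) 1)
    {Y : ℤ → Ω → ℝ} (hY : IsStationaryARCH P p a Z u Y) (t : ℤ) :
    (fun ω => Y t ω ^ 2) =ᵐ[P] localSq p a Z u t := by
  have hc := hA.coef_const hu
  refine ae_eq_archLim (φ := fun x => x ^ 2) (Y := fun t ω => Y t ω ^ 2) hA.innov hc hA.q_pos.le
    hA.q_lt hA.r_pos hA.r_lt hA.q_le_r_pow (fun t => ?_) (fun t => (hY.measurable t).pow_const 2)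
    (TightFam.sq fun ε hε => ?_) t
  · filter_upwards [hY.model t] with ω hω
    rw [hω, mul_pow, volatility, Real.sq_sqrt, mul_comm]
    exact add_nonneg (hc.nonneg 0 (Nat.zero_le _) t) (Finset.sum_nonneg fun j hj =>
      mul_nonneg (hc.nonneg' hj t) (sq_nonneg _))
  · obtain ⟨C, hC⟩ := tightFam_singleton (P := P) (hY.measurable 0) ε hε
    refine ⟨C, fun s => le_trans (le_of_eq ?_) (hC ())⟩
    have h1 := (hY.stationary s).comp (u := fun x : ℤ → ℝ => x 0) (measurable_pi_apply 0)
    have h2 := h1.measure_mem_eq (s := {x : ℝ | C < |x|})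
      (measurableSet_lt measurable_const (by fun_prop))
    rw [measureReal_def, measureReal_def]
    congr 1
    simpa [Function.comp_def, preimage] using h2

/-- For frozen parameters the same coefficient bound holds on windows of every length, so the
truncation term disappears as `k → ∞`. -/
theorem localSq_sub_norm (hA : Admissible P p a Z κ R q r β K) {u v : ℝ}
    (hu : u ∈ Ioc (0 : ℝ) 1) (hv : v ∈ Ioc (0 : ℝ) 1) (t : ℤ) :
    NormLe P (fun ω => localSq p a Z u t ω - localSq p a Z v t ω)
      (κ * (1 + p * (κ * R / (1 - q))) / (1 - q) * (K * |u - v| ^ β)) := by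
  have h : ∀ k : ℕ, NormLe P (fun ω => localSq p a Z u t ω - localSq p a Z v t ω)
      (2 * (κ * R / (1 - q) ^ 2) * q ^ k +
        κ * (1 + p * (κ * R / (1 - q))) / (1 - q) * (K * |u - v| ^ β)) := fun k =>
    archLim_sub_norm_of_window hA.innov (hA.coef_const hu) (hA.coef_const hv) hA.q_pos.le hA.q_lt
      (mul_nonneg hA.K_nonneg (by positivity)) k t
      fun s _ _ j hj => hA.holder j hj u hu v hv
  refine ⟨(h 0).1, ge_of_tendsto' (f := fun k : ℕ => ENNReal.ofReal
    (2 * (κ * R / (1 - q) ^ 2) * q ^ k +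
        κ * (1 + p * (κ * R / (1 - q))) / (1 - q) * (K * |u - v| ^ β))) (x := atTop) ?_
    fun k => (h k).2⟩
  refine (ENNReal.continuous_ofReal.tendsto _).comp ?_
  have h1 := ((tendsto_pow_atTop_nhds_zero_of_lt_one hA.q_pos.le hA.q_lt).const_mul
    (2 * (κ * R / (1 - q) ^ 2))).add_const
    (κ * (1 + p * (κ * R / (1 - q))) / (1 - q) * (K * |u - v| ^ β))
  simpa using h1

/-- Regularity in `u` yields at once integrability over `(0, 1]`, convergence of Riemann sums and
positivity of the triangle integral. -/
theorem holderIoc_integral (hA : Admissible P p a Z κ R q r β K) (t : ℤ) :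
    HolderIoc fun u => ∫ ω, localSq p a Z u t ω ∂P := by
  have h1 := hA.bound_nonneg
  have h2 := hA.one_sub_q_pos
  have h3 := hA.κ_nonneg
  have h4 := hA.K_nonneg
  refine ⟨β, κ * (1 + p * (κ * R / (1 - q))) / (1 - q) * K, hA.β_pos, by positivity,
    fun u hu v hv => ?_⟩
  rw [← integral_sub (hA.localSq_norm hu t).integrable (hA.localSq_norm hv t).integrable, mul_assoc]
  exact (hA.localSq_sub_norm hu hv t).abs_integral_le (by positivity)

theorem holderIoc_integral_mul (hA : Admissible P p a Z κ R q r β K) (s t : ℤ) :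
    HolderIoc fun u => ∫ ω, localSq p a Z u s ω * localSq p a Z u t ω ∂P := by
  have h1 := hA.bound_nonneg
  have h2 := hA.one_sub_q_pos
  have h3 := hA.κ_nonneg
  have h4 := hA.K_nonneg
  set A := κ * R / (1 - q) with hAd
  set G := κ * (1 + p * A) / (1 - q) with hG
  refine ⟨β, 2 * A * (G * K), hA.β_pos, by positivity, fun u hu v hv => ?_⟩
  have n1 := hA.localSq_norm hu s
  have n2 := hA.localSq_norm hv t
  have n3 := hA.localSq_sub_norm hu hv s
  have n4 := hA.localSq_sub_norm hu hv t
  rw [← hAd] at n1 n2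
  rw [← hAd, ← hG] at n3 n4
  have h5 : ∫ ω, localSq p a Z u s ω * localSq p a Z u t ω ∂P -
      ∫ ω, localSq p a Z v s ω * localSq p a Z v t ω ∂P =
      ∫ ω, (localSq p a Z u s ω - localSq p a Z v s ω) * localSq p a Z v t ω ∂P +
      ∫ ω, localSq p a Z u s ω * (localSq p a Z u t ω - localSq p a Z v t ω) ∂P := by
    rw [← integral_sub (n1.integrable_mul (hA.localSq_norm hu t))
      ((hA.localSq_norm hv s).integrable_mul n2),
      ← integral_add (n3.integrable_mul n2) (n1.integrable_mul n4)]
    exact integral_congr_ae (Eventually.of_forall fun ω => by ring)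
  rw [h5]
  have h6 : 0 ≤ G * (K * |u - v| ^ β) := by positivity
  refine (abs_add_le _ _).trans ?_
  linarith [n3.abs_integral_mul_le n2 h6 h1, n1.abs_integral_mul_le n4 h1 h6]

/-- Geometric decay of the local autocovariances. -/
theorem abs_integral_mul_sub_le (hA : Admissible P p a Z κ R q r β K) {u : ℝ}
    (hu : u ∈ Ioc (0 : ℝ) 1) (h : ℕ) :
    |∫ ω, localSq p a Z u 0 ω * localSq p a Z u h ω ∂P -
      (∫ ω, localSq p a Z u 0 ω ∂P) * ∫ ω, localSq p a Z u h ω ∂P| ≤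
      4 * (κ * R / (1 - q)) * (κ * R / (1 - q) ^ 2) / q * r ^ h := by
  have h1 := hA.bound_nonneg
  have h2 := hA.one_sub_q_pos
  have h3 := hA.κ_nonneg
  have hR := hA.R_nonneg
  have hc := hA.coef_const hu
  have hq := hA.q_pos
  have hr := hA.r_pos
  set A := κ * R / (1 - q) with hAd
  -- For `k > 0` this gives `k p < h`, so the windows `[-kp, 0]` and `[h - kp, h]` are disjoint; for
  -- `k = 0` the iterates vanish. On the other side `h < (p + 1)(k + 1)`, so `q ^ (k + 1) ≤ r ^ h`.
  set k := h / (p + 1) with hk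
  have hA' : 0 ≤ κ * R / (1 - q) ^ 2 := by positivity
  set A' := κ * R / (1 - q) ^ 2 with hAd'
  have hqk : q ^ k ≤ r ^ h / q := by
    rw [le_div_iff₀ hq, ← pow_succ, ← hA.r_pow, ← pow_mul]
    exact pow_le_pow_of_le_one hr.le hA.r_lt.le (Nat.lt_mul_div_succ h (Nat.succ_pos p)).le
  set x : ℤ → Ω → ℝ := fun t => localSq p a Z u t with hx
  set s : ℤ → Ω → ℝ := fun t => arch p (fun j _ => a j u) (fun s ω => Z s ω ^ 2) k t with hs
  have nx : ∀ t, NormLe P (x t) A := hA.localSq_norm hu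
  have ns : ∀ t, NormLe P (s t) A := arch_norm hA.innov hc hA.q_lt k
  have nd : ∀ t, NormLe P (fun ω => x t ω - s t ω) (A' * q ^ k) :=
    archLim_sub_norm hA.innov hc hq.le hA.q_lt k
  have hind : ∫ ω, s 0 ω * s h ω ∂P = (∫ ω, s 0 ω ∂P) * ∫ ω, s h ω ∂P := by
    rcases Nat.eq_zero_or_pos k with hk0 | hk0
    · have : ∀ t ω, s t ω = 0 := fun t ω => by simp [hs, hk0, arch]
      simp [this]
    · refine IndepFun.integral_mul_eq_mul_integral ?_ (ns 0).1 (ns h).1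
      refine indepFun_of_disjoint hA.innov.measurable hA.innov.indep ?_
        (measurable_arch_sig (φ := fun x => x ^ 2) hA.innov.measurable_fun k 0)
        (measurable_arch_sig (φ := fun x => x ^ 2) hA.innov.measurable_fun k h)
      refine Set.disjoint_left.2 fun i hi hi' => ?_
      have h4 : k * (p + 1) ≤ h := Nat.div_mul_le_self h (p + 1)
      have h5 : (k : ℤ) * (p + 1) ≤ h := by exact_mod_cast h4
      have h6 : (0 : ℤ) < k := by exact_mod_cast hk0
      have := hi.2
      have := hi'.1
      nlinarith
  have e1 : ∫ ω, x 0 ω * x h ω ∂P - ∫ ω, s 0 ω * s h ω ∂P =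
      ∫ ω, (x 0 ω - s 0 ω) * x h ω ∂P + ∫ ω, s 0 ω * (x h ω - s h ω) ∂P := by
    rw [← integral_sub ((nx 0).integrable_mul (nx h)) ((ns 0).integrable_mul (ns h)),
      ← integral_add ((nd 0).integrable_mul (nx h)) ((ns 0).integrable_mul (nd h))]
    exact integral_congr_ae (Eventually.of_forall fun ω => by ring)
  have e2 : (∫ ω, x 0 ω ∂P) * (∫ ω, x h ω ∂P) - (∫ ω, s 0 ω ∂P) * (∫ ω, s h ω ∂P) =
      (∫ ω, (x 0 ω - s 0 ω) ∂P) * (∫ ω, x h ω ∂P) +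
        (∫ ω, s 0 ω ∂P) * (∫ ω, (x h ω - s h ω) ∂P) := by
    rw [integral_sub (nx 0).integrable (ns 0).integrable,
      integral_sub (nx h).integrable (ns h).integrable]
    ring
  have hd0 : 0 ≤ A' * q ^ k := by positivity
  have b1 := (nd 0).abs_integral_mul_le (nx h) hd0 h1
  have b2 := (ns 0).abs_integral_mul_le (nd h) h1 hd0
  have b3 : |(∫ ω, (x 0 ω - s 0 ω) ∂P) * (∫ ω, x h ω ∂P)| ≤ A' * q ^ k * A := by
    rw [abs_mul]
    exact mul_le_mul ((nd 0).abs_integral_le hd0) ((nx h).abs_integral_le h1) (abs_nonneg _) hd0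
  have b4 : |(∫ ω, s 0 ω ∂P) * (∫ ω, (x h ω - s h ω) ∂P)| ≤ A * (A' * q ^ k) := by
    rw [abs_mul]
    exact mul_le_mul ((ns 0).abs_integral_le h1) ((nd h).abs_integral_le hd0) (abs_nonneg _) h1
  have e3 : ∫ ω, x 0 ω * x h ω ∂P - (∫ ω, x 0 ω ∂P) * (∫ ω, x h ω ∂P) =
      (∫ ω, (x 0 ω - s 0 ω) * x h ω ∂P + ∫ ω, s 0 ω * (x h ω - s h ω) ∂P) -
      ((∫ ω, (x 0 ω - s 0 ω) ∂P) * (∫ ω, x h ω ∂P) +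
        (∫ ω, s 0 ω ∂P) * (∫ ω, (x h ω - s h ω) ∂P)) := by
    rw [← e1, ← e2, hind]; ring
  change |∫ ω, x 0 ω * x h ω ∂P - (∫ ω, x 0 ω ∂P) * (∫ ω, x h ω ∂P)| ≤ _
  rw [e3]
  calc _ ≤ (A' * q ^ k * A + A * (A' * q ^ k)) + (A' * q ^ k * A + A * (A' * q ^ k)) :=
        (abs_sub _ _).trans (add_le_add ((abs_add_le _ _).trans (add_le_add b1 b2))
          ((abs_add_le _ _).trans (add_le_add b3 b4)))
    _ = 4 * A * A' * q ^ k := by ring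
    _ ≤ 4 * A * A' * (r ^ h / q) := by gcongr
    _ = _ := by ring

end Admissible

/-! ### Rescaled time and laws of large numbers for the frozen processes -/

theorem div_mem_Ioc {n N : ℕ} (hn : n ≤ N) {t : ℤ} (ht : t ∈ Finset.Icc (1 : ℤ) n) :
    (t : ℝ) / N ∈ Ioc (0 : ℝ) 1 := by
  rw [Finset.mem_Icc] at ht
  have h1 : (1 : ℝ) ≤ t := by exact_mod_cast ht.1
  have h2 : (t : ℝ) ≤ N := by exact_mod_cast ht.2.trans (by exact_mod_cast hn)
  exact ⟨div_pos (by linarith) (by linarith), (div_le_one (by linarith)).2 h2⟩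

/-- Rescaled time, with `t` clamped to `{1, …, N}`. -/
def rescaled (N : ℕ) (t : ℤ) : ℝ := ((max 1 (min t N) : ℤ) : ℝ) / N

theorem rescaled_mem {N : ℕ} (hN : 0 < N) (t : ℤ) : rescaled N t ∈ Ioc (0 : ℝ) 1 :=
  div_mem_Ioc le_rfl (Finset.mem_Icc.2 ⟨by omega, by omega⟩)

theorem rescaled_of_mem {N : ℕ} {t : ℤ} (h1 : 1 ≤ t) (h2 : t ≤ N) :
    rescaled N t = (t : ℝ) / N := by
  rw [rescaled, min_eq_left h2, max_eq_right h1]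

/-- Clamping fixes `t` and does not increase distances, so windows reaching before time `1` do no
harm. -/
theorem abs_rescaled_sub_le {N : ℕ} {s t : ℤ} (h1 : 1 ≤ t) (h2 : t ≤ N) {d : ℝ}
    (hd : |(s : ℝ) - t| ≤ d) : |rescaled N s - (t : ℝ) / N| ≤ d / N := by
  have hN : (0 : ℝ) < N := by exact_mod_cast (show (0 : ℤ) < N by omega)
  rw [rescaled, ← sub_div, abs_div, abs_of_pos hN]
  gcongr
  refine le_trans ?_ hd
  have h3 : |max 1 (min s N) - t| ≤ |s - t| := by
    rw [abs_le]
    constructor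
    · rcases abs_cases (s - t) with h | h <;> omega
    · rcases abs_cases (s - t) with h | h <;> omega
  exact_mod_cast h3

namespace Admissible

variable {p : ℕ} {a : ℕ → ℝ → ℝ} {Z : ℤ → Ω → ℝ} {κ R q r β K : ℝ}
variable [IsProbabilityMeasure P]

/-- The factor `1` puts the sample mean in the form of an average of products, as used in
`tendstoInMeasure_avg`. -/
theorem tendsto_integral_abs_localSq (hA : Admissible P p a Z κ R q r β K) (h : ℕ) :
    Tendsto (fun N : ℕ => ∫ ω, |1 / ((N - h : ℕ) : ℝ) * ∑ t ∈ Finset.Icc (1 : ℤ) (N - h : ℕ),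
      (localSq p a Z ((t : ℝ) / N) t ω * 1 -
        ∫ ω, localSq p a Z ((t : ℝ) / N) t ω * 1 ∂P)| ∂P) atTop (𝓝 0) := by
  simp only [mul_one]
  refine tendsto_integral_abs_avg (R := fun N t ω => localSq p a Z ((t : ℝ) / N) t ω)
    (n := fun N => N - h) (tendsto_sub_atTop_nat h)
    (fun N t ht => (hA.localSq_norm (div_mem_Ioc (Nat.sub_le N h) ht) t).integrable)
    fun ε hε => ?_
  obtain ⟨k, D, ψ, hD, hψ, H⟩ := exists_bounded_approx hA.innov hA.identDistrib hA.R_nonneg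
    hA.q_pos.le hA.q_lt hε
  refine ⟨k * p, D, fun N t => arch p (fun j _ => a j ((t : ℝ) / N)) (fun s ω => ψ (Z s ω)) k t,
    hD, fun N t ht => ?_⟩
  obtain ⟨h1, -, h3⟩ := H _ (hA.coef_const (div_mem_Ioc (Nat.sub_le N h) ht)) t
  refine ⟨(measurable_arch_sig hψ k t).mono (sig_le hA.innov.measurable _) le_rfl, h1,
    fun t' _ htt' => ?_, h3.integral_abs_le hε.le⟩
  refine indepFun_of_disjoint hA.innov.measurable hA.innov.indep ?_ (measurable_arch_sig hψ k t)
    (measurable_arch_sig hψ k t')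
  refine Set.disjoint_left.2 fun i hi hi' => ?_
  have := hi.2
  have := hi'.1
  push_cast at htt'
  linarith

theorem tendsto_integral_abs_localSq_mul (hA : Admissible P p a Z κ R q r β K) (h : ℕ) :
    Tendsto (fun N : ℕ => ∫ ω, |1 / ((N - h : ℕ) : ℝ) * ∑ t ∈ Finset.Icc (1 : ℤ) (N - h : ℕ),
      (localSq p a Z ((t : ℝ) / N) t ω * localSq p a Z ((t : ℝ) / N) (t + h) ω -
        ∫ ω, localSq p a Z ((t : ℝ) / N) t ω * localSq p a Z ((t : ℝ) / N) (t + h) ω ∂P)| ∂P)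
      atTop (𝓝 0) := by
  have hB := hA.bound_nonneg
  set A := κ * R / (1 - q) with hAd
  refine tendsto_integral_abs_avg
    (R := fun N t ω => localSq p a Z ((t : ℝ) / N) t ω * localSq p a Z ((t : ℝ) / N) (t + h) ω)
    (n := fun N => N - h) (tendsto_sub_atTop_nat h)
    (fun N t ht => (hA.localSq_norm (div_mem_Ioc (Nat.sub_le N h) ht) t).integrable_mul
      (hA.localSq_norm (div_mem_Ioc (Nat.sub_le N h) ht) (t + h)))
    fun ε hε => ?_
  -- Replacing the two factors one after the other costs `2 A` times this quantity in mean.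
  have hε' : 0 < ε / (2 * A + 1) := by positivity
  obtain ⟨k, D, ψ, hD, hψ, H⟩ := exists_bounded_approx hA.innov hA.identDistrib hA.R_nonneg
    hA.q_pos.le hA.q_lt hε'
  have hm : ∀ N t t', Measurable[sig Z (Icc (t' - k * p) t')]
      (arch p (fun j _ => a j ((t : ℝ) / N)) (fun s ω => ψ (Z s ω)) k t') :=
    fun N t t' => measurable_arch_sig hψ k t'
  have hm' : ∀ (N : ℕ) (t : ℤ), Measurable[sig Z (Icc (t - k * p) (t + h))]
      fun ω => arch p (fun j _ => a j ((t : ℝ) / N)) (fun s ω => ψ (Z s ω)) k t ω *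
        arch p (fun j _ => a j ((t : ℝ) / N)) (fun s ω => ψ (Z s ω)) k (t + h) ω := fun N t =>
    ((hm N t t).mono (sig_mono Z (Icc_subset_Icc le_rfl (by omega))) le_rfl).mul
      ((hm N t (t + h)).mono (sig_mono Z (Icc_subset_Icc (by omega) le_rfl)) le_rfl)
  refine ⟨k * p + h, D * D, _, by positivity, fun N t ht => ⟨(hm' N t).mono
    (sig_le hA.innov.measurable _) le_rfl, fun ω => ?_, fun t' _ htt' => ?_, ?_⟩⟩
  · have hc := hA.coef_const (div_mem_Ioc (Nat.sub_le N h) ht)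
    rw [abs_mul]
    exact mul_le_mul ((H _ hc t).1 ω) ((H _ hc (t + h)).1 ω) (abs_nonneg _) hD
  · refine indepFun_of_disjoint hA.innov.measurable hA.innov.indep ?_ (hm' N t) (hm' N t')
    refine Set.disjoint_left.2 fun i hi hi' => ?_
    have := hi.2
    have := hi'.1
    push_cast at htt'
    linarith
  · have hu := div_mem_Ioc (Nat.sub_le N h) ht
    have hc := hA.coef_const hu
    obtain ⟨-, h2, h3⟩ := H _ hc t
    obtain ⟨-, -, h4⟩ := H _ hc (t + h)
    have n1 := hA.localSq_norm hu (t + h)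
    rw [← hAd] at n1 h2
    have i1 := (h3.integrable_mul n1).abs
    have i2 := (h2.integrable_mul h4).abs
    have b1 := h3.integral_abs_mul_le n1 hε'.le hB
    have b2 := h2.integral_abs_mul_le h4 hB hε'.le
    refine (integral_mono_of_nonneg (Eventually.of_forall fun _ => abs_nonneg _) (i1.add i2)
      (Eventually.of_forall fun ω => ?_)).trans ?_
    · simp only [Pi.add_apply]
      refine le_trans (le_of_eq ?_) (abs_add_le _ _)
      congr 1
      simp only [localSq]
      ring
    · simp only [Pi.add_apply]
      rw [integral_add i1 i2]
      refine (add_le_add b1 b2).trans ?_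
      have : ε / (2 * A + 1) * A + A * (ε / (2 * A + 1)) = ε * (2 * A / (2 * A + 1)) := by ring
      rw [this]
      exact mul_le_of_le_one_right hε.le ((div_le_one (by positivity)).2 (by linarith))

end Admissible

/-! ### Local approximation of the tvARCH process -/

/-- The causal solution of the squared tvARCH recursion, with the parameters extended to all
times. -/
def globalSq (p : ℕ) (a : ℕ → ℝ → ℝ) (Z : ℤ → Ω → ℝ) (N : ℕ) : ℤ → Ω → ℝ :=
  archLim p (fun j t => a j (rescaled N t)) fun s ω => Z s ω ^ 2

/-- A bound for the influence of the initial values. -/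
def initialError (p : ℕ) (a : ℕ → ℝ → ℝ) (Z : ℤ → Ω → ℝ) (X : ℕ → ℤ → Ω → ℝ) (N : ℕ) (ω : Ω) : ℝ :=
  1 + ∑ i ∈ Finset.range p,
    |X N (0 - (i : ℤ)) ω ^ 2 - globalSq p a Z (max N 1) (0 - (i : ℤ)) ω|

/-- The error, at lag `h`, of the approximation by the local stationary process. -/
def localError (p : ℕ) (a : ℕ → ℝ → ℝ) (Z : ℤ → Ω → ℝ) (h N : ℕ) (t : ℤ) (ω : Ω) : ℝ :=
  |decayRec p (fun j t => a j (rescaled N t)) (fun s ω => Z s ω ^ 2) 0 N (t + h) ω| +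
    |globalSq p a Z N (t + h) ω - localSq p a Z ((t : ℝ) / N) (t + h) ω|

/-- The part of the norm of the local error that is due to the variation of the parameters. -/
def variationError (p : ℕ) (κ R q β K : ℝ) (h N : ℕ) : ℝ :=
  2 * (κ * R / (1 - q) ^ 2) * q ^ Nat.sqrt N +
    κ * (1 + p * (κ * R / (1 - q))) / (1 - q) * (K * ((h + Nat.sqrt N * p : ℝ) / N) ^ β)

/-- Using `√N` iterations balances two demands: `q ^ √N` tends to `0`, and the window has length
`o(N)`, so the parameters hardly move on it. -/
theorem tendsto_variationError (p : ℕ) (κ R : ℝ) {q β : ℝ} (K : ℝ) (hq0 : 0 ≤ q) (hq : q < 1)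
    (hβ : 0 < β) (h : ℕ) : Tendsto (variationError p κ R q β K h) atTop (𝓝 0) := by
  have hs : Tendsto Nat.sqrt atTop atTop :=
    tendsto_atTop.2 fun b => (eventually_ge_atTop (b * b)).mono fun N hN => Nat.le_sqrt.2 hN
  have h1 : Tendsto (fun N : ℕ => q ^ Nat.sqrt N) atTop (𝓝 0) :=
    (tendsto_pow_atTop_nhds_zero_of_lt_one hq0 hq).comp hs
  have h2 : Tendsto (fun N : ℕ => (h + Nat.sqrt N * p : ℝ) / N) atTop (𝓝 0) := by
    have h3 : Tendsto (fun N : ℕ => (h : ℝ) / N + p / (Nat.sqrt N : ℝ)) atTop (𝓝 0) := by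
      simpa using (tendsto_natCast_atTop_atTop.const_div_atTop (h : ℝ)).add
        ((tendsto_natCast_atTop_atTop.comp hs).const_div_atTop (p : ℝ))
    refine squeeze_zero' (Eventually.of_forall fun N => by positivity) ?_ h3
    filter_upwards [eventually_gt_atTop 0] with N hN
    have hN' : (0 : ℝ) < N := by exact_mod_cast hN
    have hs0 : (0 : ℝ) < Nat.sqrt N := by exact_mod_cast Nat.sqrt_pos.2 hN
    have hs1 : (Nat.sqrt N : ℝ) * Nat.sqrt N ≤ N := by exact_mod_cast Nat.sqrt_le N
    rw [add_div]
    refine add_le_add_right ?_ _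
    rw [div_le_div_iff₀ hN' hs0]
    nlinarith [mul_le_mul_of_nonneg_left hs1 (Nat.cast_nonneg (α := ℝ) p)]
  have h4 := (h2.rpow_const (p := β) (Or.inr hβ.le)).const_mul K |>.const_mul
    (κ * (1 + p * (κ * R / (1 - q))) / (1 - q))
  have h5 := (h1.const_mul (2 * (κ * R / (1 - q) ^ 2))).add h4
  simp only [Real.zero_rpow hβ.ne', mul_zero, add_zero] at h5
  exact h5

namespace Admissible

variable {p : ℕ} {a : ℕ → ℝ → ℝ} {Z : ℤ → Ω → ℝ} {κ R q r β K : ℝ}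

theorem variationError_nonneg (hA : Admissible P p a Z κ R q r β K) (h N : ℕ) :
    0 ≤ variationError p κ R q β K h N := by
  have h2 := hA.one_sub_q_pos
  have h3 := hA.κ_nonneg
  have h4 := hA.K_nonneg
  have h5 := hA.R_nonneg
  have h6 := hA.q_pos
  unfold variationError
  positivity

variable [IsProbabilityMeasure P]

theorem localError_norm (hA : Admissible P p a Z κ R q r β K) (h : ℕ) {N : ℕ} (hN : 0 < N) {t : ℤ}
    (ht : t ∈ Finset.Icc (1 : ℤ) (N - h : ℕ)) :
    NormLe P (localError p a Z h N t) (r ^ t + variationError p κ R q β K h N) := by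
  have hr := hA.r_pos
  have hu := div_mem_Ioc (Nat.sub_le N h) ht
  have hc := hA.coef (rescaled N) (rescaled_mem hN)
  rw [Finset.mem_Icc] at ht
  have htN : t + h ≤ N := by omega
  -- Since `t + h ≤ N`, the `N` iterations suffice. The rate `r ^ (t + h)` is weakened to `r ^ t`, a
  -- form common to all lags.
  have h1 := (decayRec_norm hA.innov hc hr hA.r_lt.le hA.q_le_r_pow 0 N (t + h)
    (by omega)).mono (zpow_le_zpow_right_of_le_one₀ hr hA.r_lt.le (show t ≤ t + h - 0 by omega))
  have h2 := archLim_sub_norm_of_window hA.innov hc (hA.coef_const hu) hA.q_pos.le hA.q_lt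
    (η := K * ((h + Nat.sqrt N * p : ℝ) / N) ^ β) (mul_nonneg hA.K_nonneg (by positivity))
    (Nat.sqrt N) (t + h) (fun s hs hs' j hj => by
      refine (hA.holder j hj _ (rescaled_mem hN s) _ hu).trans ?_
      refine mul_le_mul_of_nonneg_left (Real.rpow_le_rpow (abs_nonneg _)
        (abs_rescaled_sub_le ht.1 (by omega) ?_) hA.β_pos.le) hA.K_nonneg
      have e1 : (t : ℝ) + h - Nat.sqrt N * p ≤ s := by exact_mod_cast hs
      have e2 : (s : ℝ) ≤ t + h := by exact_mod_cast hs'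
      have e3 : (0 : ℝ) ≤ Nat.sqrt N * p := by positivity
      have e4 : (0 : ℝ) ≤ h := by positivity
      rw [abs_le]
      constructor <;> linarith)
  exact h1.abs.add h2.abs (by positivity) (hA.variationError_nonneg h N)

/-- The `max N 1` in `initialError` keeps the rescaled times in `(0, 1]` for `N = 0` too, so one
norm bound serves every `N`. -/
theorem tightFam_initialError (hA : Admissible P p a Z κ R q r β K) {X : ℕ → ℤ → Ω → ℝ}
    (hX : IsTvARCH P p a Z X) : TightFam P (initialError p a Z X) := by
  refine (TightFam.const 1).add (TightFam.sum _ fun i hi => (TightFam.sub ?_ ?_).abs)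
  · refine TightFam.sq fun ε hε => ?_
    rw [Finset.mem_range] at hi
    obtain ⟨C, hC⟩ := hX.initial_tight (0 - (i : ℤ)) (by omega) (by omega) ε hε
    exact ⟨C, fun N => ENNReal.toReal_le_of_le_ofReal hε.le (hC N)⟩
  · exact TightFam.of_normLe hA.bound_nonneg fun N => archLim_norm hA.innov
      (hA.coef (rescaled (max N 1)) (rescaled_mem (by omega))) hA.q_pos.le hA.q_lt _

/-- The triangle inequality through `globalSq`, which solves the recursion of `X_{t,N}²` at the
times `1, …, N` and so differs from it only by the initial values. Its distance to the frozen
solution is the second summand of `localError`; the `1 +` in `initialError` allows the same random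
factor there. -/
theorem abs_sq_sub_localSq_le (hA : Admissible P p a Z κ R q r β K) {X : ℕ → ℤ → Ω → ℝ}
    (hX : IsTvARCH P p a Z X) (h : ℕ) {N : ℕ} (hN : 0 < N) {t : ℤ}
    (ht : t ∈ Finset.Icc (1 : ℤ) (N - h : ℕ)) :
    ∀ᵐ ω ∂P, |X N (t + h) ω ^ 2 - localSq p a Z ((t : ℝ) / N) (t + h) ω| ≤
      initialError p a Z X N ω * |localError p a Z h N t ω| := by
  have hc := hA.coef (rescaled N) (rescaled_mem hN)
  rw [Finset.mem_Icc] at ht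
  have hrec : ∀ᵐ ω ∂P, ∀ s : ℤ, 0 < s → s ≤ N → X N s ω ^ 2 = Z s ω ^ 2 *
      (a 0 (rescaled N s) + ∑ j ∈ Finset.Icc 1 p,
        a j (rescaled N s) * X N (s - (j : ℤ)) ω ^ 2) := by
    refine ae_all_iff.2 fun s => ?_
    by_cases hs : 0 < s ∧ s ≤ N
    · filter_upwards [hX.model N s (by omega) hs.2] with ω hω _ _
      rw [hω, mul_pow, volatility, Real.sq_sqrt, mul_comm, rescaled_of_mem (by omega) hs.2]
      rw [← rescaled_of_mem (by omega) hs.2]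
      exact add_nonneg (hc.nonneg 0 (Nat.zero_le _) s) (Finset.sum_nonneg fun j hj =>
        mul_nonneg (hc.nonneg' hj s) (sq_nonneg _))
    · exact Eventually.of_forall fun ω h1 h2 => absurd ⟨h1, h2⟩ hs
  filter_upwards [hrec, archLim_eq hA.innov hc hA.q_pos.le hA.q_lt] with ω h1 h2
  have h3 := abs_sub_le_decayRec (T := N) hc (w := fun s ω => Z s ω ^ 2) (ω := ω)
    (fun t => sq_nonneg _) (s := 0) (y := fun s => X N s ω ^ 2)
    (y' := fun s => globalSq p a Z N s ω) (M := initialError p a Z X N ω) (fun s => h1 s)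
    (fun s _ _ => h2 s) (fun s hs hs' => ?_) N (t + h) (by omega) (by omega) (by omega)
  · have hM : 1 ≤ initialError p a Z X N ω :=
      le_add_of_nonneg_right (Finset.sum_nonneg fun _ _ => abs_nonneg _)
    refine (abs_sub_le _ (globalSq p a Z N (t + h) ω) _).trans ?_
    have h5 : |localError p a Z h N t ω| = localError p a Z h N t ω :=
      abs_of_nonneg (add_nonneg (abs_nonneg _) (abs_nonneg _))
    rw [h5, localError, mul_add]
    refine add_le_add (h3.trans ?_) (le_mul_of_one_le_left (abs_nonneg _) hM)
    exact mul_le_mul_of_nonneg_left (le_abs_self _) (by linarith)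
  · have h4 := abs_sub_le_sum (p := p) (fun s => X N s ω ^ 2)
      (fun s => globalSq p a Z N s ω) s hs hs'
    rw [initialError, max_eq_left (show 1 ≤ N by omega)]
    linarith

/-- Averages of products converge if both factors can be replaced and the law of large numbers
holds for the replacements. -/
theorem tendstoInMeasure_avg (hA : Admissible P p a Z κ R q r β K) {X : ℕ → ℤ → Ω → ℝ}
    (hX : IsTvARCH P p a Z X) (h : ℕ) {y y' e' : ℕ → ℤ → Ω → ℝ} {C I : ℝ}
    (hy' : ∀ᶠ N in atTop, ∀ t ∈ Finset.Icc (1 : ℤ) (N - h : ℕ), NormLe P (y' N t) C)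
    (he' : ∀ᶠ N in atTop, ∀ t ∈ Finset.Icc (1 : ℤ) (N - h : ℕ), NormLe P (e' N t)
      (r ^ t + (variationError p κ R q β K 0 N + variationError p κ R q β K h N)))
    (hy : ∀ᶠ N in atTop, ∀ t ∈ Finset.Icc (1 : ℤ) (N - h : ℕ), ∀ᵐ ω ∂P,
      |y N t ω - y' N t ω| ≤ initialError p a Z X N ω * |e' N t ω|)
    (hlln : Tendsto (fun N : ℕ => ∫ ω, |1 / ((N - h : ℕ) : ℝ) *
      ∑ t ∈ Finset.Icc (1 : ℤ) (N - h : ℕ), (localSq p a Z ((t : ℝ) / N) t ω * y' N t ω -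
        ∫ ω, localSq p a Z ((t : ℝ) / N) t ω * y' N t ω ∂P)| ∂P) atTop (𝓝 0))
    (hI : Tendsto (fun N : ℕ => 1 / ((N - h : ℕ) : ℝ) * ∑ t ∈ Finset.Icc (1 : ℤ) (N - h : ℕ),
      ∫ ω, localSq p a Z ((t : ℝ) / N) t ω * y' N t ω ∂P) atTop (𝓝 I)) :
    TendstoInMeasure P (fun (N : ℕ) ω => 1 / ((N - h : ℕ) : ℝ) *
      ∑ t ∈ Finset.Icc (1 : ℤ) (N - h : ℕ), X N t ω ^ 2 * y N t ω) atTop fun _ => I := by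
  have hr := hA.r_pos
  have hB := hA.bound_nonneg
  -- The two factors are approximated at lags `0` and `h`; the sum of both errors bounds either one.
  set v : ℕ → ℝ := fun N => variationError p κ R q β K 0 N + variationError p κ R q β K h N with hv
  have hv0 : ∀ N, 0 ≤ v N := fun N =>
    add_nonneg (hA.variationError_nonneg 0 N) (hA.variationError_nonneg h N)
  have hvlim : Tendsto v atTop (𝓝 0) := by
    simpa using (tendsto_variationError p κ R K hA.q_pos.le hA.q_lt hA.β_pos 0).add
      (tendsto_variationError p κ R K hA.q_pos.le hA.q_lt hA.β_pos h)
  -- The `2` dominates `r ^ t + v N`, because both summands are eventually at most `1`.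
  set C' : ℝ := max (max C (κ * R / (1 - q))) 2 with hC'
  have hx' : ∀ N : ℕ, ∀ t ∈ Finset.Icc (1 : ℤ) (N - h : ℕ),
      NormLe P (localSq p a Z ((t : ℝ) / N) t) (κ * R / (1 - q)) := fun N t ht =>
    hA.localSq_norm (div_mem_Ioc (Nat.sub_le N h) ht) t
  have hsub : ∀ N : ℕ, ∀ t ∈ Finset.Icc (1 : ℤ) (N - h : ℕ), t ∈ Finset.Icc (1 : ℤ) (N - 0 : ℕ) :=
    fun N t ht => by rw [Finset.mem_Icc] at ht ⊢; omega
  have h1 : TendstoInMeasure P (fun (N : ℕ) ω => 1 / ((N - h : ℕ) : ℝ) *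
      ∑ t ∈ Finset.Icc (1 : ℤ) (N - h : ℕ), (X N t ω ^ 2 * y N t ω -
        localSq p a Z ((t : ℝ) / N) t ω * y' N t ω)) atTop fun _ => 0 := by
    refine tendstoInMeasure_avg_mul_sub (n := fun N => N - h) (x := fun N t ω => X N t ω ^ 2)
      (x' := fun N t => localSq p a Z ((t : ℝ) / N) t) (e := localError p a Z 0) (e' := e')
      (M := initialError p a Z X) (ε := fun N t => r ^ t + v N) (C := C')
      (by positivity) (hA.tightFam_initialError hX)
      (fun N ω => le_add_of_nonneg_right (Finset.sum_nonneg fun _ _ => abs_nonneg _))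
      (Eventually.of_forall fun N t ht => (hx' N t ht).mono
        ((le_max_right _ _).trans (le_max_left _ _)))
      (hy'.mono fun N H t ht => (H t ht).mono ((le_max_left _ _).trans (le_max_left _ _)))
      ?_ he' ?_ ?_ ?_ hy
    · filter_upwards [eventually_gt_atTop 0] with N hN t ht
      exact (hA.localError_norm 0 hN (hsub N t ht)).mono (add_le_add_right
        (le_add_of_nonneg_right (hA.variationError_nonneg h N)) _)
    · filter_upwards [hvlim.eventually_le_const one_pos] with N hN t ht
      rw [Finset.mem_Icc] at ht
      have h2 : r ^ t ≤ 1 := by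
        simpa using zpow_le_zpow_right_of_le_one₀ hr hA.r_lt.le (show 0 ≤ t by omega)
      have h3 : (2 : ℝ) ≤ C' := le_max_right _ _
      exact ⟨add_nonneg (by positivity) (hv0 N), by linarith⟩
    · simpa using tendsto_avg_of_geometric hr.le hA.r_lt zero_le_one hvlim hv0
        (tendsto_sub_atTop_nat h)
    · filter_upwards [eventually_gt_atTop 0] with N hN t ht
      simpa using hA.abs_sq_sub_localSq_le hX 0 hN (hsub N t ht)
  have h2 : TendstoInMeasure P (fun (N : ℕ) ω => 1 / ((N - h : ℕ) : ℝ) *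
      ∑ t ∈ Finset.Icc (1 : ℤ) (N - h : ℕ), (localSq p a Z ((t : ℝ) / N) t ω * y' N t ω -
        ∫ ω, localSq p a Z ((t : ℝ) / N) t ω * y' N t ω ∂P)) atTop fun _ => 0 := by
    refine tendstoInMeasure_of_integral_abs ?_ (by simpa using hlln)
    filter_upwards [hy'] with N H
    simp only [sub_zero]
    exact (integrable_finsetSum _ fun t ht =>
      ((hx' N t ht).integrable_mul (H t ht)).sub (integrable_const _)).const_mul _
  have h3 : TendstoInMeasure P (fun (N : ℕ) (_ : Ω) => 1 / ((N - h : ℕ) : ℝ) *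
      ∑ t ∈ Finset.Icc (1 : ℤ) (N - h : ℕ),
        ∫ ω, localSq p a Z ((t : ℝ) / N) t ω * y' N t ω ∂P) atTop fun _ => I :=
    tendstoInMeasure_of_tendsto_ae (fun _ => aestronglyMeasurable_const)
      (Eventually.of_forall fun _ => hI)
  have h4 := tendstoInMeasure_comp₂ (F := fun x y => x + y)
    (tendstoInMeasure_comp₂ (F := fun x y => x + y) h1 h2 (by fun_prop)) h3 (by fun_prop)
  simp only [zero_add] at h4
  refine h4.congr_left fun N => Eventually.of_forall fun ω => ?_
  simp only [Finset.sum_sub_distrib]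
  ring

end Admissible

/-! ### From the moment condition to the `L²` contraction -/

/-- The constant is the `L^{2+ζ}`-norm of `Z_0²`. It dominates the `L²`-norm, as norms increase with
the exponent on a probability space. -/
theorem innov_sq [IsProbabilityMeasure P] {Z : ℤ → Ω → ℝ} (hZ : IsInnovation P Z) {ζ : ℝ}
    (hζ : 0 < ζ) (hint : Integrable (fun ω => |Z 0 ω| ^ (2 * (2 + ζ))) P) :
    Innov P Z (fun x => x ^ 2)
      ((∫ ω, |Z 0 ω| ^ (2 * (2 + ζ)) ∂P) ^ (1 / (2 + ζ))) := by
  have hs : 0 < 2 + ζ := by linarith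
  have hsm : Measurable fun ω => Z 0 ω ^ 2 := (hZ.measurable 0).pow_const 2
  have hpow : ∀ ω, ‖Z 0 ω ^ 2‖ ^ (2 + ζ) = |Z 0 ω| ^ (2 * (2 + ζ)) := fun ω => by
    rw [norm_pow, Real.norm_eq_abs, Real.rpow_mul (abs_nonneg _), Real.rpow_two]
  have hp0 : ENNReal.ofReal (2 + ζ) ≠ 0 := by simpa using hs
  have hL : MemLp (fun ω => Z 0 ω ^ 2) (ENNReal.ofReal (2 + ζ)) P := by
    rw [← integrable_norm_rpow_iff hsm.aestronglyMeasurable hp0 ENNReal.ofReal_ne_top,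
      ENNReal.toReal_ofReal hs.le]
    simpa only [hpow] using hint
  have h0 : NormLe P (fun ω => Z 0 ω ^ 2)
      ((∫ ω, |Z 0 ω| ^ (2 * (2 + ζ)) ∂P) ^ (1 / (2 + ζ))) := by
    refine ⟨hsm.aestronglyMeasurable, (eLpNorm_le_eLpNorm_of_exponent_le
      (q := ENNReal.ofReal (2 + ζ)) ?_ hsm.aestronglyMeasurable).trans (le_of_eq ?_)⟩
    · rw [← ENNReal.ofReal_ofNat 2]
      exact ENNReal.ofReal_le_ofReal (by linarith)
    · rw [hL.eLpNorm_eq_integral_rpow_norm hp0 ENNReal.ofReal_ne_top,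
        ENNReal.toReal_ofReal hs.le, one_div]
      simp only [hpow]
  refine ⟨hZ.measurable, hZ.indep, by fun_prop, fun x => sq_nonneg x,
    Real.rpow_nonneg (integral_nonneg fun _ => by positivity) _, fun t => ?_⟩
  refine ⟨((hZ.measurable t).pow_const 2).aestronglyMeasurable, le_trans (le_of_eq ?_) h0.2⟩
  exact ((hZ.identDistrib t).comp (u := fun x : ℝ => x ^ 2) (by fun_prop)).eLpNorm_eq 2

theorem exists_admissible [IsProbabilityMeasure P] {p : ℕ} {a : ℕ → ℝ → ℝ} {Z : ℤ → Ω → ℝ}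
    (hZ : IsInnovation P Z) (ha : ∀ j ≤ p, ∀ u ∈ Ioc (0 : ℝ) 1, 0 ≤ a j u)
    (hbdd : ParamBounded p a) (hhol : ParamHolder p a) {ζ δ : ℝ} (hζ : 0 < ζ) (hδ₀ : 0 < δ)
    (hδ₁ : δ < 1) (hmom : MomentContraction P p a Z ζ δ) :
    ∃ κ R q r β K : ℝ, Admissible P p a Z κ R q r β K := by
  obtain ⟨ρ₁, R, δ', hρ, hρR, hδ', -, hb⟩ := hbdd
  obtain ⟨β, K, hβ, -, hK, hH⟩ := hhol
  have hq : 0 < 1 - δ := by linarith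
  refine ⟨_, R, 1 - δ, (1 - δ) ^ (((p + 1 : ℕ) : ℝ)⁻¹), β, K,
    { innov := innov_sq hZ hζ hmom.1
      identDistrib := hZ.identDistrib
      coef := fun U hU => ⟨fun j hj t => ha j hj _ (hU t), fun t => (hb _ (hU t)).2.1,
        fun t => (hb _ (hU t)).2.2.trans (by linarith), fun t => hmom.2 _ (hU t)⟩
      holder := hH
      R_nonneg := by linarith
      q_pos := hq
      q_lt := by linarith
      r_pos := Real.rpow_pos_of_pos hq _
      r_lt := Real.rpow_lt_one hq.le (by linarith) (by positivity)
      r_pow := Real.rpow_inv_natCast_pow hq.le (Nat.succ_ne_zero p)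
      β_pos := hβ
      K_nonneg := hK.le }⟩

/-! ### Identification of the limit -/

namespace Admissible

variable {p : ℕ} {a : ℕ → ℝ → ℝ} {Z : ℤ → Ω → ℝ} {κ R q r β K : ℝ}
variable [IsProbabilityMeasure P]

/-- Shift invariance is inherited from the stationary process, whose squares agree almost surely
with the causal solution. -/
theorem integral_localSq_mul (hA : Admissible P p a Z κ R q r β K) {u : ℝ}
    (hu : u ∈ Ioc (0 : ℝ) 1) {Y : ℤ → Ω → ℝ} (hY : IsStationaryARCH P p a Z u Y) (t : ℤ) (h : ℕ) :
    ∫ ω, localSq p a Z u t ω * localSq p a Z u (t + h) ω ∂P =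
      ∫ ω, localSq p a Z u 0 ω * localSq p a Z u h ω ∂P := by
  have h1 : ∀ s s' : ℤ, ∫ ω, localSq p a Z u s ω * localSq p a Z u s' ω ∂P =
      ∫ ω, Y s ω ^ 2 * Y s' ω ^ 2 ∂P := fun s s' => integral_congr_ae (by
    filter_upwards [hA.sq_ae_eq_localSq hu hY s, hA.sq_ae_eq_localSq hu hY s'] with ω h1 h2
    rw [← h1, ← h2])
  rw [h1, h1]
  have h2 := ((hY.stationary t).comp (u := fun x : ℤ → ℝ => x 0 ^ 2 * x h ^ 2)
    (by fun_prop)).integral_eq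
  simpa [Function.comp_def, add_comm] using h2

theorem integral_localSq (hA : Admissible P p a Z κ R q r β K) {u : ℝ}
    (hu : u ∈ Ioc (0 : ℝ) 1) {Y : ℤ → Ω → ℝ} (hY : IsStationaryARCH P p a Z u Y) (t : ℤ) :
    ∫ ω, localSq p a Z u t ω ∂P = ∫ ω, localSq p a Z u 0 ω ∂P := by
  rw [← integral_congr_ae (hA.sq_ae_eq_localSq hu hY t),
    ← integral_congr_ae (hA.sq_ae_eq_localSq hu hY 0)]
  have h2 := ((hY.stationary t).comp (u := fun x : ℤ → ℝ => x 0 ^ 2) (by fun_prop)).integral_eq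
  simpa [Function.comp_def] using h2

variable {Xt : ℝ → ℤ → Ω → ℝ}

theorem localMean_eq (hA : Admissible P p a Z κ R q r β K)
    (hXt : ∀ u ∈ Ioc (0 : ℝ) 1, IsStationaryARCH P p a Z u (Xt u)) {u : ℝ}
    (hu : u ∈ Ioc (0 : ℝ) 1) : localMean P Xt u = ∫ ω, localSq p a Z u 0 ω ∂P :=
  integral_congr_ae (hA.sq_ae_eq_localSq hu (hXt u hu) 0)

theorem memLp_sq (hA : Admissible P p a Z κ R q r β K)
    (hXt : ∀ u ∈ Ioc (0 : ℝ) 1, IsStationaryARCH P p a Z u (Xt u)) {u : ℝ}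
    (hu : u ∈ Ioc (0 : ℝ) 1) (t : ℤ) : MemLp (fun ω => Xt u t ω ^ 2) 2 P :=
  ((hA.localSq_norm hu t).congr (hA.sq_ae_eq_localSq hu (hXt u hu) t)).memLp

theorem localCov_eq (hA : Admissible P p a Z κ R q r β K)
    (hXt : ∀ u ∈ Ioc (0 : ℝ) 1, IsStationaryARCH P p a Z u (Xt u)) {u : ℝ}
    (hu : u ∈ Ioc (0 : ℝ) 1) (h : ℕ) : localCov P Xt u h =
      ∫ ω, localSq p a Z u 0 ω * localSq p a Z u h ω ∂P -
        (∫ ω, localSq p a Z u 0 ω ∂P) * ∫ ω, localSq p a Z u h ω ∂P := by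
  have e0 := hA.sq_ae_eq_localSq hu (hXt u hu) 0
  have eh := hA.sq_ae_eq_localSq hu (hXt u hu) h
  rw [localCov, covariance_eq_sub (hA.memLp_sq hXt hu 0) (hA.memLp_sq hXt hu h),
    integral_congr_ae e0, integral_congr_ae eh]
  congr 1
  refine integral_congr_ae ?_
  filter_upwards [e0, eh] with ω h1 h2
  rw [Pi.mul_apply, h1, h2]

theorem holderIoc_localMean (hA : Admissible P p a Z κ R q r β K)
    (hXt : ∀ u ∈ Ioc (0 : ℝ) 1, IsStationaryARCH P p a Z u (Xt u)) :
    HolderIoc (localMean P Xt) := by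
  obtain ⟨β', K', hβ', hK', H⟩ := hA.holderIoc_integral 0
  refine ⟨β', K', hβ', hK', fun u hu v hv => ?_⟩
  rw [hA.localMean_eq hXt hu, hA.localMean_eq hXt hv]
  exact H u hu v hv

theorem localCov_eq_sub_sq (hA : Admissible P p a Z κ R q r β K)
    (hXt : ∀ u ∈ Ioc (0 : ℝ) 1, IsStationaryARCH P p a Z u (Xt u)) {u : ℝ}
    (hu : u ∈ Ioc (0 : ℝ) 1) (h : ℕ) : localCov P Xt u h =
      ∫ ω, localSq p a Z u 0 ω * localSq p a Z u h ω ∂P - localMean P Xt u ^ 2 := by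
  rw [hA.localCov_eq hXt hu, hA.integral_localSq hu (hXt u hu) h, hA.localMean_eq hXt hu, sq]

theorem intervalIntegrable_sq_localMean (hA : Admissible P p a Z κ R q r β K)
    (hXt : ∀ u ∈ Ioc (0 : ℝ) 1, IsStationaryARCH P p a Z u (Xt u)) :
    IntervalIntegrable (fun u => localMean P Xt u ^ 2) volume 0 1 :=
  (intervalIntegrable_iff_integrableOn_Ioc_of_le zero_le_one).2
    (hA.holderIoc_localMean hXt).integrableOn_sq

theorem intervalIntegrable_localCov (hA : Admissible P p a Z κ R q r β K)
    (hXt : ∀ u ∈ Ioc (0 : ℝ) 1, IsStationaryARCH P p a Z u (Xt u)) (h : ℕ) :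
    IntervalIntegrable (fun u => localCov P Xt u h) volume 0 1 := by
  refine ((hA.holderIoc_integral_mul 0 h).intervalIntegrable.sub
    (hA.intervalIntegrable_sq_localMean hXt)).congr fun u hu => ?_
  rw [uIoc_of_le zero_le_one] at hu
  exact (hA.localCov_eq_sub_sq hXt hu h).symm

/-- The term `∫ μ²` cancels: it is subtracted in the averaged covariance and added in the triangle
integral. -/
theorem meanLocalCov_add_meanVariation (hA : Admissible P p a Z κ R q r β K)
    (hXt : ∀ u ∈ Ioc (0 : ℝ) 1, IsStationaryARCH P p a Z u (Xt u)) (h : ℕ) :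
    meanLocalCov P Xt h + meanVariation P Xt =
      (∫ u in (0 : ℝ)..1, ∫ ω, localSq p a Z u 0 ω * localSq p a Z u h ω ∂P) -
        (∫ u in (0 : ℝ)..1, localMean P Xt u) ^ 2 := by
  rw [meanVariation, setIntegral_triangle (hA.holderIoc_localMean hXt), meanLocalCov]
  have h1 : ∫ u in (0 : ℝ)..1, localCov P Xt u h =
      ∫ u in (0 : ℝ)..1, (∫ ω, localSq p a Z u 0 ω * localSq p a Z u h ω ∂P -
        localMean P Xt u ^ 2) := by
    rw [intervalIntegral.integral_of_le zero_le_one, intervalIntegral.integral_of_le zero_le_one]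
    exact setIntegral_congr_fun measurableSet_Ioc fun u hu => hA.localCov_eq_sub_sq hXt hu h
  rw [h1, intervalIntegral.integral_sub (hA.holderIoc_integral_mul 0 h).intervalIntegrable
    (hA.intervalIntegrable_sq_localMean hXt)]
  ring

theorem abs_meanLocalCov_le (hA : Admissible P p a Z κ R q r β K)
    (hXt : ∀ u ∈ Ioc (0 : ℝ) 1, IsStationaryARCH P p a Z u (Xt u)) (h : ℕ) :
    |meanLocalCov P Xt h| ≤
      4 * (κ * R / (1 - q)) * (κ * R / (1 - q) ^ 2) / q * r ^ h := by
  have h1 := intervalIntegral.norm_integral_le_of_norm_le_const (a := (0 : ℝ)) (b := 1)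
    (f := fun u => localCov P Xt u h)
    (C := 4 * (κ * R / (1 - q)) * (κ * R / (1 - q) ^ 2) / q * r ^ h) fun u hu => by
      rw [uIoc_of_le zero_le_one] at hu
      rw [hA.localCov_eq hXt hu]
      exact hA.abs_integral_mul_sub_le hu h
  simpa [meanLocalCov] using h1

theorem tendsto_sampleMean (hA : Admissible P p a Z κ R q r β K) {X : ℕ → ℤ → Ω → ℝ}
    (hX : IsTvARCH P p a Z X) (hXt : ∀ u ∈ Ioc (0 : ℝ) 1, IsStationaryARCH P p a Z u (Xt u))
    (h : ℕ) : TendstoInMeasure P (fun (N : ℕ) ω => 1 / ((N - h : ℕ) : ℝ) *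
      ∑ t ∈ Finset.Icc (1 : ℤ) (N - h : ℕ), X N t ω ^ 2) atTop
      fun _ => ∫ u in (0 : ℝ)..1, localMean P Xt u := by
  have h1 := hA.tendstoInMeasure_avg hX h (y := fun _ _ _ => 1) (y' := fun _ _ _ => 1)
    (e' := fun _ _ _ => 0) (C := 1) (I := ∫ u in (0 : ℝ)..1, localMean P Xt u)
    (Eventually.of_forall fun N t _ => NormLe.const zero_le_one)
    (Eventually.of_forall fun N t _ => NormLe.zero.mono (add_nonneg
      (zpow_nonneg hA.r_pos.le t) (add_nonneg (hA.variationError_nonneg 0 N)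
        (hA.variationError_nonneg h N))))
    (Eventually.of_forall fun N t _ => Eventually.of_forall fun ω => by simp)
    (hA.tendsto_integral_abs_localSq h) ?_
  · simpa only [mul_one] using h1
  · refine ((hA.holderIoc_localMean hXt).tendsto_riemann h).congr fun N => ?_
    congr 1
    refine Finset.sum_congr rfl fun t ht => ?_
    have hu := div_mem_Ioc (Nat.sub_le N h) ht
    simp only [mul_one]
    rw [hA.localMean_eq hXt hu, hA.integral_localSq hu (hXt _ hu) t]

theorem tendsto_sampleProduct (hA : Admissible P p a Z κ R q r β K) {X : ℕ → ℤ → Ω → ℝ}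
    (hX : IsTvARCH P p a Z X) (hXt : ∀ u ∈ Ioc (0 : ℝ) 1, IsStationaryARCH P p a Z u (Xt u))
    (h : ℕ) : TendstoInMeasure P (fun (N : ℕ) ω => 1 / ((N - h : ℕ) : ℝ) *
      ∑ t ∈ Finset.Icc (1 : ℤ) (N - h : ℕ), X N t ω ^ 2 * X N (t + h) ω ^ 2) atTop
      fun _ => ∫ u in (0 : ℝ)..1, ∫ ω, localSq p a Z u 0 ω * localSq p a Z u h ω ∂P := by
  refine hA.tendstoInMeasure_avg hX h (y := fun N t ω => X N (t + h) ω ^ 2)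
    (y' := fun N t => localSq p a Z ((t : ℝ) / N) (t + h)) (e' := localError p a Z h)
    (C := κ * R / (1 - q))
    (Eventually.of_forall fun N t ht => hA.localSq_norm (div_mem_Ioc (Nat.sub_le N h) ht) _)
    ?_ ?_ (hA.tendsto_integral_abs_localSq_mul h) ?_
  · filter_upwards [eventually_gt_atTop 0] with N hN t ht
    exact (hA.localError_norm h hN ht).mono (add_le_add_right
      (le_add_of_nonneg_left (hA.variationError_nonneg 0 N)) _)
  · filter_upwards [eventually_gt_atTop 0] with N hN t ht
    exact hA.abs_sq_sub_localSq_le hX h hN ht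
  · refine ((hA.holderIoc_integral_mul 0 h).tendsto_riemann h).congr fun N => ?_
    congr 1
    refine Finset.sum_congr rfl fun t ht => ?_
    have hu := div_mem_Ioc (Nat.sub_le N h) ht
    exact (hA.integral_localSq_mul hu (hXt _ hu) t h).symm

theorem tendsto_sampleAutocov (hA : Admissible P p a Z κ R q r β K) {X : ℕ → ℤ → Ω → ℝ}
    (hX : IsTvARCH P p a Z X) (hXt : ∀ u ∈ Ioc (0 : ℝ) 1, IsStationaryARCH P p a Z u (Xt u))
    (h : ℕ) : TendstoInMeasure P (fun N ω => sampleAutocov X h N ω) atTop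
      fun _ => meanLocalCov P Xt h + meanVariation P Xt := by
  rw [hA.meanLocalCov_add_meanVariation hXt h]
  have h1 := tendstoInMeasure_comp₂ (F := fun x y => x - y ^ 2)
    (hA.tendsto_sampleProduct hX hXt h) (hA.tendsto_sampleMean hX hXt h) (by fun_prop)
  refine h1.congr' ?_ (ae_eq_refl _)
  -- The truncated difference `N - h` of natural numbers agrees with the real one only from `N = h`
  -- on.
  filter_upwards [eventually_ge_atTop h] with N hN
  refine Eventually.of_forall fun ω => ?_
  simp only [sampleAutocov, sampleMean, Nat.cast_sub hN]

end Admissible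

end TvARCH

end

/-- The sample autocovariance of the squares of a tvARCH(p) process, computed as if the process
were stationary, converges in probability to the averaged local autocovariance plus a term that
does not depend on the lag. The first two conclusions say that all expectations and integrals in
the limit exist; the last two make the spurious long memory precise: the first part of the limit
decays exponentially in the lag, the second is positive as soon as the local mean varies. -/
theorem proposition2 {Ω : Type*} [MeasurableSpace Ω] (P : Measure Ω) [IsProbabilityMeasure P]
    (p : ℕ) (a : ℕ → ℝ → ℝ) (Z : ℤ → Ω → ℝ) (X : ℕ → ℤ → Ω → ℝ) (Xt : ℝ → ℤ → Ω → ℝ)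
    (hZ : TvARCH.IsInnovation P Z)
    (hX : TvARCH.IsTvARCH P p a Z X)
    (hXt : ∀ u ∈ Ioc (0 : ℝ) 1, TvARCH.IsStationaryARCH P p a Z u (Xt u))
    (hbdd : TvARCH.ParamBounded p a)
    (hhol : TvARCH.ParamHolder p a)
    (ζ δ : ℝ) (hζ₀ : 0 < ζ) (hζ₂ : ζ ≤ 2) (hδ₀ : 0 < δ) (hδ₁ : δ < 1)
    (hmom : TvARCH.MomentContraction P p a Z ζ δ) :
    (∀ u ∈ Ioc (0 : ℝ) 1, ∀ t : ℤ, MemLp (fun ω => (Xt u t ω) ^ 2) 2 P) ∧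
    ((∀ h : ℕ, IntervalIntegrable (fun u => TvARCH.localCov P Xt u h) volume 0 1) ∧
      IntegrableOn
        (fun q : ℝ × ℝ => (TvARCH.localMean P Xt q.1 - TvARCH.localMean P Xt q.2) ^ 2)
        TvARCH.triangle) ∧
    (∀ h : ℕ, 0 < h →
      TendstoInMeasure P (fun N ω => TvARCH.sampleAutocov X h N ω) atTop
        (fun _ => TvARCH.meanLocalCov P Xt h + TvARCH.meanVariation P Xt)) ∧
    (∃ C ρ : ℝ, 0 < ρ ∧ ρ < 1 ∧ ∀ h : ℕ, |TvARCH.meanLocalCov P Xt h| ≤ C * ρ ^ h) ∧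
    ((∃ u ∈ Ioc (0 : ℝ) 1, ∃ v ∈ Ioc (0 : ℝ) 1,
        TvARCH.localMean P Xt u ≠ TvARCH.localMean P Xt v) →
      0 < TvARCH.meanVariation P Xt) := by
  obtain ⟨κ, R, q, r, β, K, hA⟩ :=
    TvARCH.exists_admissible hZ hX.param_nonneg hbdd hhol hζ₀ hδ₀ hδ₁ hmom
  exact ⟨fun u hu t => hA.memLp_sq hXt hu t,
    ⟨hA.intervalIntegrable_localCov hXt,
      TvARCH.integrableOn_triangle (hA.holderIoc_localMean hXt)⟩,
    fun h _ => hA.tendsto_sampleAutocov hX hXt h,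
    ⟨_, r, hA.r_pos, hA.r_lt, hA.abs_meanLocalCov_le hXt⟩,
    TvARCH.setIntegral_triangle_pos (hA.holderIoc_localMean hXt)⟩
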